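/- Let $X$ be a real Banach space with dual $X^*$, let $f\colon X\to(-\infty,\infty]$ be lower semicontinuous around $\bar x$ with $f(\bar x)<\infty$, and let $q>0$. For $f(x)<\infty$ the regular subdifferential is $$\hat\partial f(x)=\Big\{v\in X^*:\ \liminf_{y\to x}\frac{f(y)-f(x)-\langle v,y-x\rangle}{\|y-x\|}\ge 0\Big\},$$ and the basic (limiting) subdifferential $\partial f(x)$ is the set of all $v\in X^*$ for which there are sequences $x_k\to x$ with $f(x_k)\to f(x)$ and $v_k\in\hat\partial f(x_k)$ with $v_k\to v$ in the weak$^*$ topology; if $f(x)=\infty$, both sets are empty. Let $\bar x^*\in\partial f(\bar x)$, put $S:=(\partial f)^{-1}(\bar x^*)=\{x\in X:\bar x^*\in\partial f(x)\}$, let $d(\cdot\,;\Omega)$ be the distance to $\Omega$ (with $d(\cdot\,;\emptyset)=\infty$), and let $B(\bar x,\rho)$ be the closed ball. We say that $\partial f$ is $q$-subregular at $(\bar x,\bar x^*)$ with modulus $\tilde\kappa>0$ if for some $\gamma>0$ one has $d(x;S)\le\tilde\kappa\, d(\bar x^*;\partial f(x))^q$ for all $x\in B(\bar x,\gamma)$.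 Consider the following two statements. (i) $\partial f$ is $q$-subregular at $(\bar x,\bar x^*)$ with modulus $\tilde\kappa>0$, and there are $\gamma>0$ and $r\in(0,q/\kappa)$, where $\kappa:=q\tilde\kappa^{1/q}$, such that $$f(x)\ge f(\bar x)+\langle\bar x^*,x-\bar x\rangle-\frac{qr}{1+q}\,d(x;S)^{\frac{1+q}{q}}\quad\text{for all }x\in B(\bar x,\gamma).$$ (ii) There are $\alpha,\eta>0$ such that $$f(x)\ge f(\bar x)+\langle\bar x^*,x-\bar x\rangle+\frac{q\alpha}{1+q}\,d(x;S)^{\frac{1+q}{q}}\quad\text{for all }x\in B(\bar x,\eta).$$ Then: (a) If (ii) holds with some $\alpha,\eta>0$ and there is $\beta\in(0,\alpha)$ such that $$f(u)\ge f(x)+\langle x^*,u-x\rangle-\frac{q\beta}{1+q}\,d(x;S)^{\frac{1+q}{q}}$$ for all $(u,\bar x^*),(x,x^*)$ in the graph of $\partial f$ that lie in the closed ball of $X\times X^*$ with center $(\bar x,\bar x^*)$ and radius $\eta+\big(\frac{q\eta}{1+q}\big)^{1/q}$ for the norm $\|x\|+\|x^*\|$, then (i) holds for some $\tilde\kappa>0$.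 (b) Conversely, if $X$ is Asplund (every separable subspace of $X$ has a separable dual) and (i) holds with some $\tilde\kappa>0$, then for every $\alpha\in(0,q/\kappa)$ there is $\eta>0$ such that the inequality in (ii) holds with these $\alpha$ and $\eta$. -/

import Mathlib

open Set Filter Topology

namespace VarAnalysis

/-- Asplund space: every separable subspace has a separable (norm) dual. -/
def IsAsplund (X : Type*) [NormedAddCommGroup X] [NormedSpace ℝ X] : Prop :=
  ∀ Y : Submodule ℝ X, TopologicalSpace.SeparableSpace Y →
    TopologicalSpace.SeparableSpace (StrongDual ℝ Y)

variable {X : Type*} [NormedAddCommGroup X] [NormedSpace ℝ X]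

/-- The regular (Fréchet) subdifferential of `f` at `x`: the functionals `v` with
`liminf_{y → x} (f y - f x - ⟨v, y - x⟩) / ‖y - x‖ ≥ 0`, written with the denominator cleared.
It is empty where `f` is not finite. -/
def regularSubdifferential (f : X → EReal) (x : X) : Set (StrongDual ℝ X) :=
  {v | f x ≠ ⊤ ∧ f x ≠ ⊥ ∧ ∀ ε : ℝ, 0 < ε →
    ∀ᶠ y in 𝓝 x, f x + ((v (y - x) - ε * ‖y - x‖ : ℝ) : EReal) ≤ f y}

/-- The basic (limiting, Mordukhovich) subdifferential of `f` at `x`: all limits, in the weak-star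
topology, of sequences of regular subgradients of `f` at points `u k → x` with `f (u k) → f x`.
It is empty where `f` is not finite. -/
def limitingSubdifferential (f : X → EReal) (x : X) : Set (StrongDual ℝ X) :=
  {v | f x ≠ ⊤ ∧ f x ≠ ⊥ ∧ ∃ (u : ℕ → X) (w : ℕ → StrongDual ℝ X),
    Tendsto u atTop (𝓝 x) ∧ Tendsto (fun k => f (u k)) atTop (𝓝 (f x)) ∧
    Tendsto (fun k => StrongDual.toWeakDual (w k)) atTop (𝓝 (StrongDual.toWeakDual v)) ∧
    ∀ k, w k ∈ regularSubdifferential f (u k)}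

/-- The inverse of a set-valued mapping. -/
def setValuedInverse {A B : Type*} (F : A → Set B) (b : B) : Set A := {a | b ∈ F a}

/-- The set-valued mapping `F` is metrically `q`-subregular at `(x₀, y₀)`, a point of its graph,
with modulus `κ`. Distances are extended-valued, so that the distance to the empty set is `∞`. -/
def IsSubregularWith {A B : Type*} [PseudoMetricSpace A] [PseudoMetricSpace B]
    (F : A → Set B) (q : ℝ) (x₀ : A) (y₀ : B) (κ : ℝ) : Prop :=
  y₀ ∈ F x₀ ∧ 0 < κ ∧ ∃ γ : ℝ, 0 < γ ∧ ∀ x ∈ Metric.closedBall x₀ γ,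
    Metric.infEDist x (setValuedInverse F y₀) ≤
      ENNReal.ofReal κ * Metric.infEDist y₀ (F x) ^ q

/-- `d(x; (∂f)⁻¹(v))`, used only when `(∂f)⁻¹(v)` is non-empty. -/
noncomputable def distToInverse (f : X → EReal) (v : StrongDual ℝ X) (x : X) : ℝ :=
  Metric.infDist x (setValuedInverse (limitingSubdifferential f) v)

/-- For all `x` in the closed ball of radius `ρ` about `x₀`,
`f x ≥ f x₀ + ⟨v, x - x₀⟩ + (q c / (1 + q)) d(x; (∂f)⁻¹(v)) ^ ((1 + q) / q)`.
With `c = α > 0` this is the growth condition, with `c = -r < 0` the weak lower estimate. -/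
def LowerEstimate (f : X → EReal) (q : ℝ) (x₀ : X) (v : StrongDual ℝ X) (c ρ : ℝ) : Prop :=
  ∀ x ∈ Metric.closedBall x₀ ρ,
    f x₀ + ((v (x - x₀) + q * c / (1 + q) * distToInverse f v x ^ ((1 + q) / q) : ℝ) : EReal) ≤ f x

/-- `∂f` is `q`-subregular at `(x₀, v)` with modulus `κ'`, and the weak lower estimate holds near
`x₀` with some constant `r ∈ (0, q / κ)`, where `κ = q κ' ^ (1 / q)`. -/
def SubregularAndLowerEstimate (f : X → EReal) (q : ℝ) (x₀ : X) (v : StrongDual ℝ X)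
    (κ' : ℝ) : Prop :=
  IsSubregularWith (limitingSubdifferential f) q x₀ v κ' ∧
    ∃ γ r : ℝ, 0 < γ ∧ 0 < r ∧ r < q / (q * κ' ^ (1 / q)) ∧ LowerEstimate f q x₀ v (-r) γ

/-- For all points `(u, v)` and `(x, w)` of the graph of `∂f` within distance `R` of `(x₀, v)`, in
the sum norm of the product space,
`f u ≥ f x + ⟨w, u - x⟩ - (q β / (1 + q)) d(x; (∂f)⁻¹(v)) ^ ((1 + q) / q)`. -/
def GraphEstimate (f : X → EReal) (q : ℝ) (x₀ : X) (v : StrongDual ℝ X) (β R : ℝ) : Prop :=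
  ∀ (u x : X) (w : StrongDual ℝ X),
    v ∈ limitingSubdifferential f u → w ∈ limitingSubdifferential f x →
    ‖u - x₀‖ ≤ R → ‖x - x₀‖ + ‖w - v‖ ≤ R →
    f x + ((w (u - x) - q * β / (1 + q) * distToInverse f v x ^ ((1 + q) / q) : ℝ) : EReal) ≤ f u

end VarAnalysis

open VarAnalysis

/-! Write d for the distance to S, p = (1+q)/q and K = q/κ. Since (q/(1+q)) t^p has derivative
t^(1/q), growth of order p and subregularity of order q have matching scales.

For (a), take w in ∂f(x) and u in S near x. The graph estimate at (u, x), the same estimate at (x₀,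
u), where d(u) = 0, and the growth of f at x add up to q(α-β)/(1+q) d(x)^p ≤ ‖w - v‖ ‖x - u‖.
Letting u approach the distance and dividing by d(x) gives subregularity. See
`mul_distToInverse_le_of_graphEstimate`.

For (b), `LowerEstimate.improve` raises the constant C of a lower estimate to C + δ while |C| < K,
with δ small compared with K - |C|. If the better estimate fails at x, Ekeland's principle applied
to f - v - (qC/(1+q)) d^p gives a nearby point c of slope O(δ) d(c)^(1/q). So f - v has slope at
most (|C| + O(δ)) d(c)^(1/q) there, up to arbitrarily small errors. In an Asplund space a regular
subgradient of about that norm exists close to c, which subregularity forbids. Starting from C = -r,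
finitely many steps reach α, because |C| ≤ max r α < K throughout.

The Asplund input is `exists_regularSubgradient_of_slope`. If the space and its dual are separable,
a smooth variational principle provides it. The general case follows by separable reduction:
existence of a subgradient is equivalent to a family of finite inequalities, and a suitable
separable subspace detects every violated one. -/

namespace VarAnalysis

/-! ### Smooth approximation of the norm when the dual is separable -/

section SmoothNormApproximation

theorem infDist_midpoint_le {E : Type*} [NormedAddCommGroup E] [NormedSpace ℝ E] {C : Set E}
    (hC : IsCompact C) (hne : C.Nonempty) (hconv : Convex ℝ C) (a b : E) :
    Metric.infDist ((1 / 2 : ℝ) • (a + b)) C ≤ (Metric.infDist a C + Metric.infDist b C) / 2 := by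
  obtain ⟨c, hc, hac⟩ := hC.exists_infDist_eq_dist hne a
  obtain ⟨d, hd, hbd⟩ := hC.exists_infDist_eq_dist hne b
  have hmem : (1 / 2 : ℝ) • (c + d) ∈ C := by
    rw [smul_add]
    exact hconv hc hd (by norm_num) (by norm_num) (by norm_num)
  calc Metric.infDist ((1 / 2 : ℝ) • (a + b)) C
      ≤ dist ((1 / 2 : ℝ) • (a + b)) ((1 / 2 : ℝ) • (c + d)) := Metric.infDist_le_dist_of_mem hmem
    _ = (1 / 2) * ‖(a - c) + (b - d)‖ := by
        rw [dist_eq_norm, ← smul_sub, norm_smul, Real.norm_of_nonneg (by norm_num)]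
        congr 2; abel
    _ ≤ (1 / 2) * (‖a - c‖ + ‖b - d‖) := by gcongr; exact norm_add_le _ _
    _ = _ := by rw [hac, hbd, dist_eq_norm, dist_eq_norm]; ring

variable {Y : Type*} [NormedAddCommGroup Y] [NormedSpace ℝ Y]

/-- The distance to a norm compact set of functionals is weak-star lower semicontinuous. -/
theorem lowerSemicontinuous_infDist_weakDual {C : Set (StrongDual ℝ Y)} (hC : IsCompact C)
    (hne : C.Nonempty) :
    LowerSemicontinuous fun w : WeakDual ℝ Y => Metric.infDist (WeakDual.toStrongDual w) C := by
  rw [lowerSemicontinuous_iff_isClosed_preimage]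
  intro a
  have hC' : IsCompact (StrongDual.toWeakDual '' C : Set (WeakDual ℝ Y)) :=
    hC.image NormedSpace.Dual.toWeakDual_continuous
  have hB := WeakDual.isCompact_closedBall (𝕜 := ℝ) (0 : StrongDual ℝ Y) a
  -- The sublevel set is C plus a closed dual ball, a sum of two weak-star compact sets.
  convert (hC'.add hB).isClosed using 1
  ext w
  simp only [mem_preimage, mem_Iic, Set.mem_add, mem_image]
  constructor
  · intro h
    obtain ⟨c, hc, hwc⟩ := hC.exists_infDist_eq_dist hne (WeakDual.toStrongDual w)
    refine ⟨StrongDual.toWeakDual c, ⟨c, hc, rfl⟩, w - StrongDual.toWeakDual c, ?_, by abel⟩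
    rw [Metric.mem_closedBall, dist_zero_right, map_sub]
    rw [hwc, dist_eq_norm] at h
    exact h
  · rintro ⟨_, ⟨c, hc, rfl⟩, b, hb, rfl⟩
    refine (Metric.infDist_le_dist_of_mem hc).trans ?_
    rw [Metric.mem_closedBall, dist_zero_right] at hb
    rw [dist_eq_norm, map_add]
    simpa using hb

/-- The finite dimensional compact convex sets exhausting the dual along the sequence `ω`. -/
def dualHull (ω : ℕ → StrongDual ℝ Y) (n : ℕ) : Set (StrongDual ℝ Y) :=
  convexHull ℝ (insert 0 (ω '' Iic n))

theorem isCompact_dualHull (ω : ℕ → StrongDual ℝ Y) (n : ℕ) : IsCompact (dualHull ω n) :=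
  (((finite_Iic n).image ω).insert 0).isCompact_convexHull ℝ

theorem zero_mem_dualHull (ω : ℕ → StrongDual ℝ Y) (n : ℕ) : 0 ∈ dualHull ω n :=
  subset_convexHull ℝ _ (mem_insert _ _)

theorem mem_dualHull (ω : ℕ → StrongDual ℝ Y) (n : ℕ) : ω n ∈ dualHull ω n :=
  subset_convexHull ℝ _ (mem_insert_of_mem _ ⟨n, mem_Iic.2 le_rfl, rfl⟩)

/-- Distance to the `n`-th hull. -/
noncomputable def hullDist (ω : ℕ → StrongDual ℝ Y) (n : ℕ) (w : StrongDual ℝ Y) : ℝ :=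
  Metric.infDist w (dualHull ω n)

/-- Evaluation at the `n`-th point, scaled to norm at most one. -/
noncomputable def scaledEval (z : ℕ → Y) (n : ℕ) (w : StrongDual ℝ Y) : ℝ :=
  w (z n) / (1 + ‖z n‖)

/-- The terms of the penalty `dualPenalty`. -/
noncomputable def penaltyTerm (ω : ℕ → StrongDual ℝ Y) (z : ℕ → Y) (n : ℕ)
    (w : StrongDual ℝ Y) : ℝ :=
  (1 / 2) ^ n * (hullDist ω n w ^ 2 + scaledEval z n w ^ 2)

/-- A convex weak-star lower semicontinuous penalty making maximizing sequences converge. -/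
noncomputable def dualPenalty (ω : ℕ → StrongDual ℝ Y) (z : ℕ → Y) (w : StrongDual ℝ Y) : ℝ :=
  ∑' n, penaltyTerm ω z n w

variable (ω : ℕ → StrongDual ℝ Y) (z : ℕ → Y)

theorem hullDist_nonneg (n : ℕ) (w : StrongDual ℝ Y) : 0 ≤ hullDist ω n w :=
  Metric.infDist_nonneg

theorem hullDist_le (n : ℕ) (w : StrongDual ℝ Y) : hullDist ω n w ≤ ‖w‖ := by
  simpa [hullDist] using Metric.infDist_le_dist_of_mem (x := w) (zero_mem_dualHull ω n)

theorem abs_scaledEval_le (n : ℕ) (w : StrongDual ℝ Y) : |scaledEval z n w| ≤ ‖w‖ := by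
  have h0 : 0 < 1 + ‖z n‖ := by positivity
  rw [scaledEval, abs_div, abs_of_pos h0, div_le_iff₀ h0]
  have := w.le_opNorm (z n)
  rw [Real.norm_eq_abs] at this
  nlinarith [norm_nonneg w]

theorem penaltyTerm_nonneg (n : ℕ) (w : StrongDual ℝ Y) : 0 ≤ penaltyTerm ω z n w := by
  unfold penaltyTerm; positivity

theorem penaltyTerm_le (n : ℕ) (w : StrongDual ℝ Y) :
    penaltyTerm ω z n w ≤ (1 / 2) ^ n * (2 * ‖w‖ ^ 2) := by
  unfold penaltyTerm
  have h1 : hullDist ω n w ^ 2 ≤ ‖w‖ ^ 2 :=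
    pow_le_pow_left₀ (hullDist_nonneg ω n w) (hullDist_le ω n w) 2
  have h2 : scaledEval z n w ^ 2 ≤ ‖w‖ ^ 2 := by
    rw [← sq_abs]
    exact pow_le_pow_left₀ (abs_nonneg _) (abs_scaledEval_le z n w) 2
  gcongr
  linarith

theorem summable_penaltyTerm (w : StrongDual ℝ Y) : Summable fun n => penaltyTerm ω z n w :=
  Summable.of_nonneg_of_le (penaltyTerm_nonneg ω z · w) (penaltyTerm_le ω z · w)
    (summable_geometric_two.mul_right _)

theorem dualPenalty_nonneg (w : StrongDual ℝ Y) : 0 ≤ dualPenalty ω z w :=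
  tsum_nonneg (penaltyTerm_nonneg ω z · w)

theorem dualPenalty_le (w : StrongDual ℝ Y) : dualPenalty ω z w ≤ 4 * ‖w‖ ^ 2 := by
  calc dualPenalty ω z w ≤ ∑' n : ℕ, (1 / 2 : ℝ) ^ n * (2 * ‖w‖ ^ 2) :=
        (summable_penaltyTerm ω z w).tsum_le_tsum (penaltyTerm_le ω z · w)
          (summable_geometric_two.mul_right _)
    _ = 4 * ‖w‖ ^ 2 := by rw [tsum_mul_right, tsum_geometric_two]; ring

theorem lowerSemicontinuous_penaltyTerm (n : ℕ) :
    LowerSemicontinuous fun w : WeakDual ℝ Y => penaltyTerm ω z n (WeakDual.toStrongDual w) := by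
  have h1 := lowerSemicontinuous_infDist_weakDual (isCompact_dualHull ω n)
    ⟨0, zero_mem_dualHull ω n⟩
  -- Squaring is not monotone on ℝ; the truncated square is, and it agrees with the square on
  -- distances.
  have hc : Continuous fun t : ℝ => max t 0 ^ 2 := by fun_prop
  have hm : Monotone fun t : ℝ => max t 0 ^ 2 := fun s t hst =>
    pow_le_pow_left₀ (le_max_right _ _) (max_le_max hst le_rfl) 2
  have h2 := hc.comp_lowerSemicontinuous h1 hm
  have h3 : Continuous fun w : WeakDual ℝ Y => scaledEval z n (WeakDual.toStrongDual w) ^ 2 :=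
    ((WeakDual.eval_continuous (𝕜 := ℝ) (z n)).div_const _).pow 2
  have h4 := h2.add h3.lowerSemicontinuous
  have h5 := (continuous_const_mul ((1 / 2 : ℝ) ^ n)).comp_lowerSemicontinuous h4
    (monotone_mul_left_of_nonneg (by positivity))
  have heq : ∀ w : WeakDual ℝ Y, (1 / 2 : ℝ) ^ n *
      (max (Metric.infDist (WeakDual.toStrongDual w) (dualHull ω n)) 0 ^ 2 +
        scaledEval z n (WeakDual.toStrongDual w) ^ 2) =
      penaltyTerm ω z n (WeakDual.toStrongDual w) := fun w => by
    rw [max_eq_left Metric.infDist_nonneg, penaltyTerm, hullDist]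
  simpa only [Function.comp_def, heq] using h5

theorem lowerSemicontinuous_dualPenalty :
    LowerSemicontinuous fun w : WeakDual ℝ Y => dualPenalty ω z (WeakDual.toStrongDual w) := by
  intro w a ha
  obtain ⟨N, hN⟩ := (((summable_penaltyTerm ω z
    (WeakDual.toStrongDual w)).hasSum.eventually (lt_mem_nhds ha))).exists
  have hs : LowerSemicontinuous fun w : WeakDual ℝ Y =>
      ∑ n ∈ N, penaltyTerm ω z n (WeakDual.toStrongDual w) :=
    lowerSemicontinuous_sum fun n _ => lowerSemicontinuous_penaltyTerm ω z n
  filter_upwards [hs w a hN] with w' hw'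
  exact lt_of_lt_of_le hw' ((summable_penaltyTerm ω z _).sum_le_tsum N
    fun n _ => penaltyTerm_nonneg ω z n _)

/-- Quantitative convexity from the parallelogram identity for squares of reals. It controls the
differences of `hullDist` and `scaledEval`, not `‖a - b‖`; density of `ω` and `z` makes up for this
later. -/
theorem penaltyTerm_midpoint (n : ℕ) (a b : StrongDual ℝ Y) :
    penaltyTerm ω z n ((1 / 2 : ℝ) • (a + b)) + (1 / 4) * ((1 / 2) ^ n *
      ((hullDist ω n a - hullDist ω n b) ^ 2 + (scaledEval z n a - scaledEval z n b) ^ 2)) ≤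
    (penaltyTerm ω z n a + penaltyTerm ω z n b) / 2 := by
  have h1 : hullDist ω n ((1 / 2 : ℝ) • (a + b)) ≤ (hullDist ω n a + hullDist ω n b) / 2 :=
    infDist_midpoint_le (isCompact_dualHull ω n) ⟨0, zero_mem_dualHull ω n⟩
      (convex_convexHull ℝ _) a b
  have h2 : scaledEval z n ((1 / 2 : ℝ) • (a + b)) = (scaledEval z n a + scaledEval z n b) / 2 := by
    simp [scaledEval]; ring
  have h3 : hullDist ω n ((1 / 2 : ℝ) • (a + b)) ^ 2 ≤
      ((hullDist ω n a + hullDist ω n b) / 2) ^ 2 :=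
    pow_le_pow_left₀ (hullDist_nonneg ω n _) h1 2
  unfold penaltyTerm
  rw [h2]
  have hp : (0 : ℝ) ≤ (1 / 2) ^ n := by positivity
  have := mul_le_mul_of_nonneg_left h3 hp
  nlinarith

theorem dualPenalty_midpoint (n : ℕ) (a b : StrongDual ℝ Y) :
    dualPenalty ω z ((1 / 2 : ℝ) • (a + b)) + (1 / 4) * ((1 / 2) ^ n *
      ((hullDist ω n a - hullDist ω n b) ^ 2 + (scaledEval z n a - scaledEval z n b) ^ 2)) ≤
    (dualPenalty ω z a + dualPenalty ω z b) / 2 := by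
  have hs := ((summable_penaltyTerm ω z a).add (summable_penaltyTerm ω z b)).div_const 2
  have hd := hs.sub (summable_penaltyTerm ω z ((1 / 2 : ℝ) • (a + b)))
  have h := hd.le_tsum n fun k _ => by
    have := penaltyTerm_midpoint ω z k a b
    have h0 : 0 ≤ (1 / 4 : ℝ) * ((1 / 2) ^ k * ((hullDist ω k a - hullDist ω k b) ^ 2 +
      (scaledEval z k a - scaledEval z k b) ^ 2)) := by positivity
    linarith
  rw [hs.tsum_sub (summable_penaltyTerm ω z _), tsum_div_const,
    (summable_penaltyTerm ω z a).tsum_add (summable_penaltyTerm ω z b)] at h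
  have := penaltyTerm_midpoint ω z n a b
  unfold dualPenalty
  linarith

/-- A penalized maximization problem on a dual ball is well posed. -/
theorem exists_strong_maximizer (hω : DenseRange ω) (hz : DenseRange z) {L c : ℝ} (hL : 0 < L)
    (hc : 0 < c) (y : Y) :
    ∃ w : StrongDual ℝ Y, ‖w‖ ≤ L ∧
      (∀ w', ‖w'‖ ≤ L → w' y - c * dualPenalty ω z w' ≤ w y - c * dualPenalty ω z w) ∧
      ∀ ε > 0, ∃ δ > 0, ∀ w', ‖w'‖ ≤ L →
        w y - c * dualPenalty ω z w - δ < w' y - c * dualPenalty ω z w' → ‖w' - w‖ < ε := by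
  have husc : LowerSemicontinuous fun w : WeakDual ℝ Y =>
      c * dualPenalty ω z (WeakDual.toStrongDual w) + -(w y) :=
    ((continuous_const_mul c).comp_lowerSemicontinuous (lowerSemicontinuous_dualPenalty ω z)
      (monotone_mul_left_of_nonneg hc.le)).add
      (WeakDual.eval_continuous (𝕜 := ℝ) y).neg.lowerSemicontinuous
  obtain ⟨w, hwL, hwmax⟩ := (husc.lowerSemicontinuousOn
    (WeakDual.toStrongDual ⁻¹' Metric.closedBall (0 : StrongDual ℝ Y) L)).exists_isMinOn
    ⟨0, by simp [hL.le]⟩ (WeakDual.isCompact_closedBall 0 L)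
  obtain ⟨w, rfl⟩ := StrongDual.toWeakDual.surjective w
  have hwL' : ‖w‖ ≤ L := by simpa using hwL
  have hmax : ∀ w', ‖w'‖ ≤ L →
      w' y - c * dualPenalty ω z w' ≤ w y - c * dualPenalty ω z w := by
    intro w' hw'
    have h : c * dualPenalty ω z w + -(w y) ≤ c * dualPenalty ω z w' + -(w' y) :=
      hwmax (show StrongDual.toWeakDual w' ∈ _ by simpa using hw')
    linarith
  refine ⟨w, hwL', hmax, ?_⟩
  -- The midpoint of w' and w is a competitor, so the convexity gap is bounded by the defect of w'
  -- from the maximum.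
  have hgap : ∀ n w', ‖w'‖ ≤ L →
      c / 2 * (1 / 2) ^ n * ((hullDist ω n w' - hullDist ω n w) ^ 2 +
        (scaledEval z n w' - scaledEval z n w) ^ 2) ≤
      (w y - c * dualPenalty ω z w) - (w' y - c * dualPenalty ω z w') := by
    intro n w' hw'
    have h1 := dualPenalty_midpoint ω z n w' w
    have h2 := hmax ((1 / 2 : ℝ) • (w' + w)) (by
      rw [norm_smul, Real.norm_of_nonneg (by norm_num)]
      linarith [norm_add_le w' w])
    have h3 : ((1 / 2 : ℝ) • (w' + w)) y = (w' y + w y) / 2 := by simp; ring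
    rw [h3] at h2
    have h4 := mul_le_mul_of_nonneg_left h1 hc.le
    nlinarith
  by_contra! hcon
  obtain ⟨ε, hε, hcon⟩ := hcon
  choose s hsL hsgap hsfar using fun k : ℕ => hcon (1 / ((k : ℝ) + 1)) (by positivity)
  have hgap0 : ∀ n, Tendsto (fun k => (hullDist ω n (s k) - hullDist ω n w) ^ 2 +
      (scaledEval z n (s k) - scaledEval z n w) ^ 2) atTop (𝓝 0) := by
    intro n
    have hpos : 0 < c / 2 * (1 / 2) ^ n := by positivity
    refine squeeze_zero (g := fun k : ℕ => (1 / ((k : ℝ) + 1)) / (c / 2 * (1 / 2) ^ n))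
      (fun k => by positivity) (fun k => ?_) ?_
    · rw [le_div_iff₀ hpos]
      have := hgap n (s k) (hsL k)
      have := hsgap k
      linarith
    · simpa using tendsto_one_div_add_atTop_nhds_zero_nat.div_const (c / 2 * (1 / 2 : ℝ) ^ n)
  have habs : ∀ {a b : ℕ → ℝ}, Tendsto (fun k => a k ^ 2 + b k ^ 2) atTop (𝓝 0) →
      Tendsto a atTop (𝓝 0) := by
    intro a b h
    have h2 : Tendsto (fun k => Real.sqrt (a k ^ 2 + b k ^ 2)) atTop (𝓝 0) := by
      simpa using h.sqrt
    refine squeeze_zero_norm (fun k => ?_) h2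
    rw [Real.norm_eq_abs]
    exact Real.abs_le_sqrt (by nlinarith [sq_nonneg (b k)])
  have hd : ∀ n, Tendsto (fun k => hullDist ω n (s k)) atTop (𝓝 (hullDist ω n w)) := fun n => by
    simpa using (habs (hgap0 n)).add_const (hullDist ω n w)
  have he : ∀ n, Tendsto (fun k => scaledEval z n (s k)) atTop (𝓝 (scaledEval z n w)) := fun n => by
    have h := (hgap0 n).congr fun k => add_comm _ _
    simpa using (habs h).add_const (scaledEval z n w)
  -- Some hull is close to w, hence eventually to s k. Hulls are compact, so the ultrafilter
  -- contains arbitrarily small balls and converges in norm. The limit is w by evaluation at the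
  -- points of `z`, against `hsfar`.
  let U : Ultrafilter (StrongDual ℝ Y) := Ultrafilter.of (map s atTop)
  have hU : (U : Filter _) ≤ map s atTop := Ultrafilter.of_le _
  have hcauchy : Cauchy (U : Filter (StrongDual ℝ Y)) := by
    refine Metric.cauchy_iff.2 ⟨U.neBot, fun r hr => ?_⟩
    obtain ⟨n, hn⟩ := hω.exists_dist_lt w (show 0 < r / 8 by positivity)
    have hdn : hullDist ω n w < r / 8 :=
      (Metric.infDist_le_dist_of_mem (mem_dualHull ω n)).trans_lt hn
    have hev : ∀ᶠ x in (U : Filter _), hullDist ω n x < r / 8 :=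
      hU ((hd n).eventually (gt_mem_nhds hdn))
    obtain ⟨t, -, htf, hcov⟩ := (isCompact_dualHull ω n).finite_cover_balls
      (show 0 < r / 8 by positivity)
    have hsub : ∀ᶠ x in (U : Filter _), x ∈ ⋃ a ∈ t, Metric.ball a (r / 2) := by
      filter_upwards [hev] with x hx
      obtain ⟨a, ha, hxa⟩ := (Metric.infDist_lt_iff ⟨0, zero_mem_dualHull ω n⟩).1 hx
      have := hcov ha
      simp only [mem_iUnion, Metric.mem_ball, exists_prop] at this ⊢
      obtain ⟨i, hi, hai⟩ := this
      exact ⟨i, hi, by linarith [dist_triangle x a i]⟩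
    obtain ⟨a, -, ha⟩ := (Ultrafilter.finite_biUnion_mem_iff htf).1 hsub
    refine ⟨_, ha, fun x hx x' hx' => ?_⟩
    rw [Metric.mem_ball] at hx hx'
    linarith [dist_triangle_right x x' a]
  obtain ⟨w', hw'⟩ := CompleteSpace.complete hcauchy
  have heq : w' = w := by
    have hfun : (w' : Y → ℝ) = w := by
      refine Continuous.ext_on hz w'.continuous w.continuous ?_
      rintro _ ⟨n, rfl⟩
      have h1 : Tendsto (fun x => scaledEval z n x) (U : Filter _) (𝓝 (scaledEval z n w)) :=
        Tendsto.mono_left (tendsto_map'_iff.2 (he n)) hU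
      have hcont : Continuous fun x : StrongDual ℝ Y => scaledEval z n x := by
        unfold scaledEval; fun_prop
      have h2 := (hcont.tendsto w').mono_left hw'
      have h3 := tendsto_nhds_unique h2 h1
      have h0 : (1 + ‖z n‖) ≠ 0 := by positivity
      exact (div_left_inj' h0).1 h3
    exact DFunLike.coe_injective hfun
  have hfar : ∀ᶠ x in (U : Filter _), ε ≤ ‖x - w‖ :=
    hU (Filter.Eventually.of_forall (f := atTop) hsfar)
  have hnear : ∀ᶠ x in (U : Filter _), ‖x - w‖ < ε := by
    have := hw' (Metric.ball_mem_nhds w' hε)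
    filter_upwards [this] with x hx
    rwa [heq, Metric.mem_ball, dist_eq_norm] at hx
  have := U.neBot
  obtain ⟨x, hx1, hx2⟩ := (hfar.and hnear).exists
  linarith

/-- In a separable space with separable dual, multiples of the norm are uniform limits of
everywhere Fréchet differentiable functions with the same Lipschitz constant. -/
theorem exists_smooth_norm_approx [TopologicalSpace.SeparableSpace Y]
    [TopologicalSpace.SeparableSpace (StrongDual ℝ Y)] {L δ : ℝ} (hL : 0 < L) (hδ : 0 < δ) :
    ∃ (φ : Y → ℝ) (φ' : Y → StrongDual ℝ Y), (∀ y, HasFDerivAt φ (φ' y) y) ∧ (∀ y, ‖φ' y‖ ≤ L) ∧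
      ∀ y, L * ‖y‖ - δ ≤ φ y ∧ φ y ≤ L * ‖y‖ := by
  set ω := TopologicalSpace.denseSeq (StrongDual ℝ Y)
  set z := TopologicalSpace.denseSeq Y
  have hω : DenseRange ω := TopologicalSpace.denseRange_denseSeq _
  have hz : DenseRange z := TopologicalSpace.denseRange_denseSeq _
  -- The penalty is at most 4 L² on the ball of radius L, so it costs at most δ.
  set c : ℝ := δ / (4 * L ^ 2) with hcdef
  have hc : 0 < c := by positivity
  choose w hwL hwmax hwstrong using fun y => exists_strong_maximizer ω z hω hz hL hc y
  -- With φ the maximum value, `hup` and `hlow` say w_y(h) ≤ φ(y+h) - φ(y) ≤ w_(y+h)(h). Thus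
  -- Fréchet differentiability reduces to norm continuity of the maximizer.
  have hup : ∀ y h, (w (y + h) (y + h) - c * dualPenalty ω z (w (y + h))) ≤
      w y y - c * dualPenalty ω z (w y) + w (y + h) h := by
    intro y h
    have := hwmax y (w (y + h)) (hwL _)
    rw [map_add]; linarith
  have hlow : ∀ y h, w y y - c * dualPenalty ω z (w y) + w y h ≤
      (w (y + h) (y + h) - c * dualPenalty ω z (w (y + h))) := by
    intro y h
    have := hwmax (y + h) (w y) (hwL _)
    rw [map_add] at this; linarith
  refine ⟨fun y => w y y - c * dualPenalty ω z (w y), w, fun y => ?_, hwL, fun y => ⟨?_, ?_⟩⟩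
  · rw [hasFDerivAt_iff_isLittleO_nhds_zero, Asymptotics.isLittleO_iff]
    intro ε hε
    obtain ⟨d, hd, hdε⟩ := hwstrong y ε hε
    -- At y, the maximizer for y + h misses the maximum by at most 2L‖h‖.
    have hb : ∀ᶠ h : Y in 𝓝 0, ‖h‖ < d / (2 * L) := by
      have := Metric.ball_mem_nhds (0 : Y) (show 0 < d / (2 * L) by positivity)
      filter_upwards [this] with h hh
      simpa using hh
    filter_upwards [hb] with h hh
    rw [lt_div_iff₀ (by positivity)] at hh
    have e1 : |w (y + h) h| ≤ L * ‖h‖ :=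
      ((w (y + h)).le_opNorm h).trans (by gcongr; exact hwL _)
    have e2 : |w y h| ≤ L * ‖h‖ := ((w y).le_opNorm h).trans (by gcongr; exact hwL _)
    have hclose : ‖w (y + h) - w y‖ < ε := by
      refine hdε _ (hwL _) ?_
      have := hlow y h
      rw [map_add] at this
      linarith [abs_le.1 e1, abs_le.1 e2]
    have e3 : |(w (y + h) - w y) h| ≤ ε * ‖h‖ :=
      ((w (y + h) - w y).le_opNorm h).trans (by gcongr)
    rw [_root_.sub_apply] at e3
    rw [Real.norm_eq_abs, abs_le]
    constructor
    · have := hlow y h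
      have : 0 ≤ ε * ‖h‖ := by positivity
      linarith
    · have := hup y h
      linarith [(abs_le.1 e3).2]
  · obtain ⟨g, hg, hgy⟩ := exists_dual_vector'' ℝ y
    have hLg : ‖L • g‖ ≤ L := by
      rw [norm_smul, Real.norm_of_nonneg hL.le]; nlinarith
    have h1 := hwmax y (L • g) hLg
    have h2 := dualPenalty_le ω z (L • g)
    have h3 : c * dualPenalty ω z (L • g) ≤ δ := by
      have : ‖L • g‖ ^ 2 ≤ L ^ 2 := pow_le_pow_left₀ (norm_nonneg _) hLg 2
      calc c * dualPenalty ω z (L • g) ≤ c * (4 * L ^ 2) := by gcongr; linarith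
        _ = δ := by rw [hcdef]; field_simp
    have h4 : (L • g) y = L * ‖y‖ := by simp [hgy]
    rw [h4] at h1
    linarith
  · have h1 := (le_abs_self _).trans ((w y).le_opNorm y)
    have h2 : ‖w y‖ * ‖y‖ ≤ L * ‖y‖ := by gcongr; exact hwL y
    have h3 := mul_nonneg hc.le (dualPenalty_nonneg ω z (w y))
    linarith

end SmoothNormApproximation

/-! ### Variational principles -/

section VariationalPrinciple

theorem exists_approx_minimizer {E : Type*} {A : Set E} (hA : A.Nonempty) {F : E → ℝ} {b : ℝ}
    (hb : ∀ y ∈ A, b ≤ F y) {ε : ℝ} (hε : 0 < ε) : ∃ x ∈ A, ∀ y ∈ A, F x ≤ F y + ε := by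
  have hne : (F '' A).Nonempty := hA.image F
  have hbdd : BddBelow (F '' A) := ⟨b, by rintro _ ⟨y, hy, rfl⟩; exact hb y hy⟩
  obtain ⟨_, ⟨x, hx, rfl⟩, hlt⟩ := exists_lt_of_csInf_lt hne (lt_add_of_pos_right (sInf (F '' A)) hε)
  exact ⟨x, hx, fun y hy => by linarith [csInf_le hbdd (mem_image_of_mem F hy)]⟩

/-- A variational principle of Ekeland and Borwein–Preiss type: the perturbation is a sum of
translates of prescribed approximations of multiples of the norm. -/
theorem exists_perturbed_minimizer {E : Type*} [NormedAddCommGroup E] [CompleteSpace E]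
    {K : Set E} (hK : IsClosed K) {G : E → EReal} (hG : ∀ x ∈ K, LowerSemicontinuousAt G x)
    {m : ℝ} (hm : ∀ x ∈ K, (m : EReal) ≤ G x) {x₀ : E} (hx₀ : x₀ ∈ K) {e a : ℝ} (he : 0 < e)
    (ha : 0 < a) (hGx₀ : G x₀ ≤ ((m + e : ℝ) : EReal)) {φ : ℕ → E → ℝ}
    (hlip : ∀ n y y', |φ n y - φ n y'| ≤ a * (1 / 2) ^ (n + 1) * ‖y - y'‖)
    (hzero : ∀ n, φ n 0 ≤ 0)
    (hlow : ∀ n y, a * (1 / 2) ^ (n + 1) * ‖y‖ - e * (1 / 4) ^ n ≤ φ n y) :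
    ∃ (x : ℕ → E) (c : E), c ∈ K ∧ ‖c - x₀‖ ≤ 9 * e / a ∧ G c ≠ ⊤ ∧
      (∀ y, Summable fun n => φ n (y - x n)) ∧
      (∀ y y', |∑' n, φ n (y - x n) - ∑' n, φ n (y' - x n)| ≤ a * ‖y - y'‖) ∧
      ∀ y ∈ K, G c + ((∑' n, φ n (c - x n) - ∑' n, φ n (y - x n) : ℝ) : EReal) ≤ G y := by
  have hbot : ∀ x ∈ K, G x ≠ ⊥ := fun x hx h => by
    have := hm x hx
    rw [h, le_bot_iff] at this
    exact EReal.coe_ne_bot m this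
  set A : Set E := {x | x ∈ K ∧ G x ≠ ⊤} with hAdef
  set H : E → ℝ := fun x => (G x).toReal with hHdef
  have hGH : ∀ x ∈ A, G x = (H x : EReal) := fun x hx =>
    (EReal.coe_toReal hx.2 (hbot x hx.1)).symm
  have hHm : ∀ x ∈ A, m ≤ H x := fun x hx => by
    have := hm x hx.1
    rwa [hGH x hx, EReal.coe_le_coe_iff] at this
  have hx₀A : x₀ ∈ A := ⟨hx₀, fun h => by
    rw [h, top_le_iff] at hGx₀
    exact EReal.coe_ne_top _ hGx₀⟩
  have hHx₀ : H x₀ ≤ m + e := by rwa [hGH x₀ hx₀A, EReal.coe_le_coe_iff] at hGx₀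
  have hsel : ∀ (P : E → ℝ) (n : ℕ), (∃ b, ∀ y, b ≤ P y) →
      ∃ x ∈ A, ∀ y ∈ A, H x + P x ≤ H y + P y + e * (1 / 4) ^ n := by
    rintro P n ⟨b, hb⟩
    exact exists_approx_minimizer (F := fun y => H y + P y) (b := m + b) ⟨x₀, hx₀A⟩
      (fun y hy => add_le_add (hHm y hy) (hb y)) (by positivity)
  choose! sel hselA hselmin using hsel
  -- The state is the current point and the perturbation accumulated before it.
  let s : ℕ → E × (E → ℝ) := fun n => Nat.rec (x₀, fun _ => 0)
    (fun n p => (sel (fun y => p.2 y + φ n (y - p.1)) (n + 1),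
      fun y => p.2 y + φ n (y - p.1))) n
  set x : ℕ → E := fun n => (s n).1 with hxdef
  have hP : ∀ n, (s n).2 = fun y => ∑ k ∈ Finset.range n, φ k (y - x k) := by
    intro n
    induction n with
    | zero => rfl
    | succ n ih =>
      funext y
      rw [Finset.sum_range_succ]
      change (s n).2 y + φ n (y - (s n).1) = _
      rw [ih]
  set P : ℕ → E → ℝ := fun n y => ∑ k ∈ Finset.range n, φ k (y - x k) with hPdef
  have hPb : ∀ n, ∃ b, ∀ y, b ≤ P n y := fun n =>
    ⟨∑ k ∈ Finset.range n, -(e * (1 / 4) ^ k), fun y => Finset.sum_le_sum fun k _ => by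
      have := hlow k (y - x k)
      have : 0 ≤ a * (1 / 2) ^ (k + 1) * ‖y - x k‖ := by positivity
      linarith⟩
  have hxs : ∀ n, x (n + 1) = sel (P (n + 1)) (n + 1) := by
    intro n
    have h : P (n + 1) = (s (n + 1)).2 := (hP (n + 1)).symm
    rw [h]
  have hmin : ∀ n, x n ∈ A ∧ ∀ y ∈ A, H (x n) + P n (x n) ≤ H y + P n y + e * (1 / 4) ^ n := by
    intro n
    cases n with
    | zero =>
      refine ⟨hx₀A, fun y hy => ?_⟩
      have h1 : x 0 = x₀ := rfl
      have := hHm y hy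
      simp only [hPdef, Finset.range_zero, Finset.sum_empty, pow_zero, h1]
      linarith
    | succ n =>
      rw [hxs]
      exact ⟨hselA _ _ (hPb _), hselmin _ _ (hPb _)⟩
  have hstep : ∀ n, dist (x n) (x (n + 1)) ≤ 9 / 2 * e / a * (1 / 2) ^ n := by
    intro n
    have h1 := (hmin (n + 1)).2 (x n) (hmin n).1
    have h2 := (hmin n).2 (x (n + 1)) (hmin (n + 1)).1
    have h3 := hlow n (x (n + 1) - x n)
    have h4 : ∀ y, P (n + 1) y = P n y + φ n (y - x n) := fun y => Finset.sum_range_succ _ _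
    rw [h4, h4, sub_self] at h1
    have h5 := hzero n
    rw [dist_comm, dist_eq_norm]
    -- Three errors add up: e/4^n from `hlow`, e/4^n from the near-minimality of x n, and e/4^(n+1)
    -- from that of x (n+1).
    have h6 : a * (1 / 2) ^ (n + 1) * ‖x (n + 1) - x n‖ ≤ 9 / 4 * e * (1 / 4) ^ n := by
      rw [pow_succ] at h1
      linarith
    have h7 : (1 / 4 : ℝ) ^ n = (1 / 2) ^ n * (1 / 2) ^ n := by rw [← mul_pow]; norm_num
    have h8 : (0 : ℝ) < (1 / 2) ^ n := by positivity
    rw [h7, pow_succ] at h6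
    have h9 : a * ‖x (n + 1) - x n‖ ≤ 9 / 2 * e * (1 / 2) ^ n := by
      refine le_of_mul_le_mul_left ?_ h8
      linarith
    rw [div_mul_eq_mul_div, le_div_iff₀ ha]
    linarith
  have hcau := cauchySeq_of_le_geometric _ _ (by norm_num) hstep
  obtain ⟨c, hc⟩ := cauchySeq_tendsto_of_complete hcau
  have hdist : ∀ n, dist (x n) c ≤ 9 * e / a := by
    intro n
    refine (dist_le_of_le_geometric_of_tendsto _ _ (by norm_num) hstep hc n).trans ?_
    have h1 : (1 / 2 : ℝ) ^ n ≤ 1 := pow_le_one₀ (by norm_num) (by norm_num)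
    have h2 : 0 < 9 / 2 * e / a := by positivity
    calc 9 / 2 * e / a * (1 / 2) ^ n / (1 - 1 / 2) ≤ 9 / 2 * e / a * 1 / (1 - 1 / 2) := by
          gcongr
      _ = 9 * e / a := by ring
  have hcK : c ∈ K := hK.mem_of_tendsto hc (Eventually.of_forall fun n => (hmin n).1.1)
  have hgeo : Summable fun n : ℕ => a * (1 / 2 : ℝ) ^ (n + 1) := by
    simp_rw [pow_succ]
    exact (summable_geometric_two.mul_right _).mul_left a
  have hgeosum : ∑' n : ℕ, a * (1 / 2 : ℝ) ^ (n + 1) = a := by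
    simp_rw [pow_succ]
    rw [tsum_mul_left, tsum_mul_right, tsum_geometric_two]; ring
  have hsum : ∀ y, Summable fun n => φ n (y - x n) := by
    intro y
    refine Summable.of_norm_bounded (g := fun n => a * (1 / 2) ^ (n + 1) *
      (‖y - c‖ + 9 * e / a) + e * (1 / 4) ^ n)
      ((hgeo.mul_right _).add ((summable_geometric_of_lt_one (by norm_num) (by norm_num)).mul_left e))
      fun n => ?_
    have h1 : ‖y - x n‖ ≤ ‖y - c‖ + 9 * e / a := by
      have := hdist n
      rw [dist_comm, dist_eq_norm] at this
      calc ‖y - x n‖ = ‖(y - c) + (c - x n)‖ := by congr 1; abel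
        _ ≤ _ := (norm_add_le _ _).trans (by linarith)
    have h2 : a * (1 / 2) ^ (n + 1) * ‖y - x n‖ ≤ a * (1 / 2) ^ (n + 1) * (‖y - c‖ + 9 * e / a) := by
      gcongr
    have h3 := hlow n (y - x n)
    have h4 := hlip n (y - x n) 0
    rw [sub_zero] at h4
    have h5 : 0 ≤ a * (1 / 2) ^ (n + 1) * ‖y - x n‖ := by positivity
    have h6 : 0 < e * (1 / 4) ^ n := by positivity
    rw [Real.norm_eq_abs, abs_le]
    constructor
    · linarith
    · linarith [(abs_le.1 h4).2, hzero n]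
  have hPlip : ∀ n y y', |P n y - P n y'| ≤ a * ‖y - y'‖ := by
    intro n y y'
    rw [hPdef]
    simp only
    rw [← Finset.sum_sub_distrib]
    calc |∑ k ∈ Finset.range n, (φ k (y - x k) - φ k (y' - x k))|
        ≤ ∑ k ∈ Finset.range n, |φ k (y - x k) - φ k (y' - x k)| := Finset.abs_sum_le_sum_abs _ _
      _ ≤ ∑ k ∈ Finset.range n, a * (1 / 2) ^ (k + 1) * ‖y - y'‖ := by
          refine Finset.sum_le_sum fun k _ => ?_
          simpa using hlip k (y - x k) (y' - x k)
      _ = (∑ k ∈ Finset.range n, a * (1 / 2) ^ (k + 1)) * ‖y - y'‖ := by rw [Finset.sum_mul]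
      _ ≤ a * ‖y - y'‖ := by
          gcongr
          exact (hgeo.sum_le_tsum (Finset.range n) fun k _ => by positivity).trans hgeosum.le
  have hPtend : ∀ y, Tendsto (fun n => P n y) atTop (𝓝 (∑' n, φ n (y - x n))) := fun y =>
    (hsum y).hasSum.tendsto_sum_nat
  have hΦlip : ∀ y y', |∑' n, φ n (y - x n) - ∑' n, φ n (y' - x n)| ≤ a * ‖y - y'‖ := fun y y' =>
    le_of_tendsto ((hPtend y).sub (hPtend y')).abs (Eventually.of_forall fun n => hPlip n y y')
  have hle : ∀ y ∈ A, G c ≤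
      ((H y + ∑' n, φ n (y - x n) - ∑' n, φ n (c - x n) : ℝ) : EReal) := by
    intro y hy
    by_contra! hlt
    obtain ⟨t, ht1, ht2⟩ := EReal.lt_iff_exists_real_btwn.1 hlt
    rw [EReal.coe_lt_coe_iff] at ht1
    have hev : ∀ᶠ n in atTop, t < H (x n) := by
      filter_upwards [hc.eventually (hG c hcK t ht2)] with n hn
      have hn' : (t : EReal) < G (x n) := hn
      rwa [hGH _ (hmin n).1, EReal.coe_lt_coe_iff] at hn'
    have hPx : Tendsto (fun n => P n (x n)) atTop (𝓝 (∑' n, φ n (c - x n))) := by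
      have h1 : Tendsto (fun n => P n (x n) - P n c) atTop (𝓝 0) := by
        refine squeeze_zero_norm (a := fun n => a * dist (x n) c) (fun n => ?_) ?_
        · rw [dist_eq_norm]
          exact hPlip n _ _
        · simpa using (tendsto_iff_dist_tendsto_zero.1 hc).const_mul a
      simpa using h1.add (hPtend c)
    have hlim : Tendsto (fun n => H y + P n y - P n (x n) + e * (1 / 4) ^ n) atTop
        (𝓝 (H y + ∑' n, φ n (y - x n) - ∑' n, φ n (c - x n) + e * 0)) :=
      (((hPtend y).const_add (H y)).sub hPx).add
        ((tendsto_pow_atTop_nhds_zero_of_lt_one (by norm_num) (by norm_num)).const_mul e)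
    have := ge_of_tendsto hlim (hev.mono fun n hn => by
      have := (hmin n).2 y hy
      show t ≤ _
      linarith)
    linarith
  have hGc : G c ≠ ⊤ := fun h => by
    have := hle x₀ hx₀A
    rw [h, top_le_iff] at this
    exact EReal.coe_ne_top _ this
  have hcA : c ∈ A := ⟨hcK, hGc⟩
  refine ⟨x, c, hcK, ?_, hGc, hsum, hΦlip, fun y hy => ?_⟩
  · have := hdist 0
    rw [dist_comm, dist_eq_norm] at this
    exact this
  · by_cases hyt : G y = ⊤
    · rw [hyt]; exact le_top
    · have hyA : y ∈ A := ⟨hy, hyt⟩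
      have := hle y hyA
      rw [hGH c hcA, EReal.coe_le_coe_iff] at this
      rw [hGH c hcA, hGH y hyA, ← EReal.coe_add, EReal.coe_le_coe_iff]
      linarith

/-- Ekeland's variational principle, up to constants. -/
theorem exists_small_slope {E : Type*} [NormedAddCommGroup E] [CompleteSpace E]
    {K : Set E} (hK : IsClosed K) {G : E → EReal} (hG : ∀ x ∈ K, LowerSemicontinuousAt G x)
    {m : ℝ} (hm : ∀ x ∈ K, (m : EReal) ≤ G x) {x₀ : E} (hx₀ : x₀ ∈ K) {e a : ℝ} (he : 0 < e)
    (ha : 0 < a) (hGx₀ : G x₀ ≤ ((m + e : ℝ) : EReal)) :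
    ∃ c ∈ K, ‖c - x₀‖ ≤ 9 * e / a ∧ G c ≠ ⊤ ∧
      ∀ y ∈ K, G c + ((-(a * ‖y - c‖) : ℝ) : EReal) ≤ G y := by
  obtain ⟨x, c, hcK, hdist, hGc, -, hlip, hmin⟩ := exists_perturbed_minimizer hK hG hm hx₀ he ha hGx₀
    (φ := fun n y => a * (1 / 2) ^ (n + 1) * ‖y‖)
    (fun n y y' => by
      rw [← mul_sub, abs_mul, abs_of_nonneg (by positivity)]
      gcongr
      exact abs_norm_sub_norm_le y y')
    (fun n => by simp) (fun n y => by
      have : 0 < e * (1 / 4) ^ n := by positivity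
      linarith)
  refine ⟨c, hcK, hdist, hGc, fun y hy => le_trans ?_ (hmin y hy)⟩
  gcongr
  have := (abs_le.1 (hlip y c)).2
  linarith

theorem lowerSemicontinuousAt_add_coe {E : Type*} [TopologicalSpace E] {g : E → EReal} {x : E}
    (hg : LowerSemicontinuousAt g x) {h : E → ℝ} (hh : ContinuousAt h x) :
    LowerSemicontinuousAt (fun y => g y + (h y : EReal)) x :=
  hg.add' (continuous_coe_real_ereal.continuousAt.comp hh).lowerSemicontinuousAt
    (EReal.continuousAt_add (Or.inr (EReal.coe_ne_bot _)) (Or.inr (EReal.coe_ne_top _)))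

end VariationalPrinciple

/-! ### Regular subgradients at points of small slope: separable case -/

section SeparableCase

variable {Y : Type*} [NormedAddCommGroup Y] [NormedSpace ℝ Y]

/-- In a space with separable dual, a point of slope at most `L` is a limit of points with regular
subgradients of norm almost at most `L`. -/
theorem exists_regularSubgradient_of_separable [CompleteSpace Y]
    [TopologicalSpace.SeparableSpace Y] [TopologicalSpace.SeparableSpace (StrongDual ℝ Y)]
    {g : Y → EReal} (hbot : ∀ y, g y ≠ ⊥) {u : Y} (hu : g u ≠ ⊤)
    (hlsc : ∀ᶠ y in 𝓝 u, LowerSemicontinuousAt g y) {L : ℝ} (hL : 0 ≤ L)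
    (hmin : ∀ᶠ y in 𝓝 u, g u + ((-(L * ‖y - u‖) : ℝ) : EReal) ≤ g y) {ε : ℝ} (hε : 0 < ε) :
    ∃ y, ‖y - u‖ < ε ∧ ∃ w ∈ regularSubdifferential g y, ‖w‖ ≤ L + ε := by
  obtain ⟨ρ, hρ, hball⟩ := Metric.eventually_nhds_iff_ball.1 (hlsc.and hmin)
  set R : ℝ := min (ρ / 2) (ε / 2) with hRdef
  have hR : 0 < R := by positivity
  have hKρ : ∀ y ∈ Metric.closedBall u R, y ∈ Metric.ball u ρ := fun y hy => by
    rw [Metric.mem_closedBall] at hy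
    rw [Metric.mem_ball]
    linarith [min_le_left (ρ / 2) (ε / 2)]
  -- With a = ε/2 the displacement bound 9e/a equals R/2, so the minimizer is interior to the ball.
  set e : ℝ := ε * R / 36 with hedef
  have he : 0 < e := by positivity
  obtain ⟨ψ, ψ', hψ, hψ', hψb⟩ := exists_smooth_norm_approx (Y := Y)
    (show 0 < L + ε / 2 by positivity) he
  choose φ φ' hφ hφ' hφb using fun n : ℕ => exists_smooth_norm_approx (Y := Y)
    (show 0 < ε / 2 * (1 / 2) ^ (n + 1) by positivity) (show 0 < e * (1 / 4) ^ n by positivity)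
  obtain ⟨r, hr⟩ : ∃ r : ℝ, g u = r := ⟨_, (EReal.coe_toReal hu (hbot u)).symm⟩
  have hψc : Continuous ψ := continuous_iff_continuousAt.2 fun y => (hψ y).continuousAt
  obtain ⟨x, c, hcK, hcu, hGc, hsum, -, hmin'⟩ :=
    exists_perturbed_minimizer (K := Metric.closedBall u R) Metric.isClosed_closedBall
    (G := fun y => g y + (ψ (y - u) : EReal)) (m := r - e) (x₀ := u) (e := e) (a := ε / 2)
    (fun y hy => lowerSemicontinuousAt_add_coe (hball y (hKρ y hy)).1 (by fun_prop))
    -- The slope bound is absorbed by ψ ≥ (L + ε/2)‖·‖ - e, so u minimizes the sum up to e.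
    (fun y hy => by
      have h1 := (hball y (hKρ y hy)).2
      have h2 := (hψb (y - u)).1
      have h3 : 0 ≤ ε / 2 * ‖y - u‖ := by positivity
      rw [hr, ← EReal.coe_add] at h1
      refine le_trans ?_ (add_le_add_left h1 _)
      rw [← EReal.coe_add, EReal.coe_le_coe_iff]
      linarith)
    (Metric.mem_closedBall_self hR.le) he (by positivity)
    (by
      rw [hr, ← EReal.coe_add, EReal.coe_le_coe_iff]
      have := (hψb (u - u)).2
      rw [sub_self, norm_zero, mul_zero] at this
      rw [sub_self]
      linarith)
    (φ := φ)
    (fun n y y' => by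
      have := convex_univ.norm_image_sub_le_of_norm_hasFDerivWithin_le
        (fun x _ => (hφ n x).hasFDerivWithinAt) (fun x _ => hφ' n x) (mem_univ y') (mem_univ y)
      rwa [Real.norm_eq_abs] at this)
    (fun n => by simpa using (hφb n 0).2) (fun n y => (hφb n y).1)
  have hcu' : ‖c - u‖ ≤ R / 2 := by
    refine hcu.trans (le_of_eq ?_)
    rw [hedef]; field_simp; norm_num
  have hcε : ‖c - u‖ < ε := by
    have := min_le_right (ρ / 2) (ε / 2)
    linarith
  have hgeo : Summable fun n : ℕ => ε / 2 * (1 / 2 : ℝ) ^ (n + 1) := by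
    simp_rw [pow_succ]
    exact (summable_geometric_two.mul_right _).mul_left _
  have hgeosum : ∑' n : ℕ, ε / 2 * (1 / 2 : ℝ) ^ (n + 1) = ε / 2 := by
    simp_rw [pow_succ]
    rw [tsum_mul_left, tsum_mul_right, tsum_geometric_two]; ring
  have hΦ : HasFDerivAt (fun y => ∑' n, φ n (y - x n)) (∑' n, φ' n (c - x n)) c :=
    hasFDerivAt_tsum hgeo (fun n y => (hasFDerivAt_comp_sub (x n)).2 (hφ n (y - x n)))
      (fun n y => hφ' n _) (hsum c) c
  have hΨ := ((hasFDerivAt_comp_sub u).2 (hψ (c - u))).add hΦ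
  set D : StrongDual ℝ Y := ψ' (c - u) + ∑' n, φ' n (c - x n) with hD
  have hDn : ‖D‖ ≤ L + ε := by
    have h1 : ‖∑' n, φ' n (c - x n)‖ ≤ ε / 2 :=
      (tsum_of_norm_bounded hgeo.hasSum fun n => hφ' n _).trans hgeosum.le
    have h2 := norm_add_le (ψ' (c - u)) (∑' n, φ' n (c - x n))
    linarith [hψ' (c - u)]
  have hgc : g c ≠ ⊤ := fun h => hGc (by simp [h])
  refine ⟨c, hcε, -D, ⟨hgc, hbot c, fun η hη => ?_⟩, by rwa [norm_neg]⟩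
  have hnhds : Metric.closedBall u R ∈ 𝓝 c := by
    refine Filter.mem_of_superset (Metric.ball_mem_nhds c (show 0 < R / 2 by positivity)) ?_
    intro y hy
    rw [Metric.mem_ball] at hy
    rw [Metric.mem_closedBall]
    have := dist_triangle y c u
    rw [dist_eq_norm c u] at this
    linarith
  filter_upwards [hnhds, (Asymptotics.isLittleO_iff.1 hΨ.isLittleO) hη] with y hyK hy
  have h1 := hmin' y hyK
  by_cases hgy : g y = ⊤
  · rw [hgy]; exact le_top
  obtain ⟨s, hs⟩ : ∃ s : ℝ, g c = s := ⟨_, (EReal.coe_toReal hgc (hbot c)).symm⟩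
  obtain ⟨t, ht⟩ : ∃ t : ℝ, g y = t := ⟨_, (EReal.coe_toReal hgy (hbot y)).symm⟩
  simp only [hs, ht, ← EReal.coe_add, EReal.coe_le_coe_iff] at h1 ⊢
  rw [Real.norm_eq_abs] at hy
  have h2 := (abs_le.1 hy).2
  simp only [Pi.add_apply] at h2
  rw [_root_.neg_apply]
  linarith

end SeparableCase

/-! ### Separable reduction in Asplund spaces -/

section SeparableReduction

theorem exists_countable_closed_under {α ι : Type*} [Countable ι] {H : ι → α → α → Set α}
    (hH : ∀ i a b, (H i a b).Countable) {S : Set α} (hS : S.Countable) :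
    ∃ D : Set α, D.Countable ∧ S ⊆ D ∧ ∀ i, ∀ a ∈ D, ∀ b ∈ D, H i a b ⊆ D := by
  let D : ℕ → Set α := fun n => Nat.rec S
    (fun _ T => T ∪ ⋃ i, ⋃ a ∈ T, ⋃ b ∈ T, H i a b) n
  have hsucc : ∀ n, D (n + 1) = D n ∪ ⋃ i, ⋃ a ∈ D n, ⋃ b ∈ D n, H i a b := fun n => rfl
  have hcount : ∀ n, (D n).Countable := by
    intro n
    induction n with
    | zero => exact hS
    | succ n ih =>
      rw [hsucc]
      exact ih.union (countable_iUnion fun i => ih.biUnion fun a _ => ih.biUnion fun b _ => hH i a b)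
  have hmono : Monotone D := monotone_nat_of_le_succ fun n => by
    rw [hsucc]; exact subset_union_left
  refine ⟨⋃ n, D n, countable_iUnion hcount, subset_iUnion D 0, fun i a ha b hb x hx => ?_⟩
  obtain ⟨m, hm⟩ := mem_iUnion.1 ha
  obtain ⟨n, hn⟩ := mem_iUnion.1 hb
  refine mem_iUnion.2 ⟨max m n + 1, ?_⟩
  rw [hsucc]
  refine Or.inr ?_
  simp only [mem_iUnion]
  exact ⟨i, a, hmono (le_max_left m n) hm, b, hmono (le_max_right m n) hn, hx⟩

variable {X : Type*} [NormedAddCommGroup X] [NormedSpace ℝ X]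

/-- The finite tests deciding whether `g` has a regular subgradient of norm at most `c` at `y`,
where `γ` stands for the value of `g` at `y`. -/
noncomputable def configValue (g : X → EReal) (c : ℝ) (y : X) (γ : ℝ) {k : ℕ} (p : Fin k → ℝ)
    (n : Fin k → ℕ) (u : Fin k → X) : ℝ :=
  ∑ i, p i * ((g (u i)).toReal - γ + ‖u i - y‖ / ((n i : ℝ) + 1)) + c * ‖∑ i, p i • (u i - y)‖

/-- The Lipschitz constant in the base point does not depend on the points u i, so tests at a dense
set of base points suffice. -/
theorem configValue_le_add (g : X → EReal) {c : ℝ} (hc : 0 ≤ c) (y z : X) (γ : ℝ) {k : ℕ}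
    {p : Fin k → ℝ} (hp : ∀ i, 0 ≤ p i) (n : Fin k → ℕ) (u : Fin k → X) :
    configValue g c z γ p n u ≤ configValue g c y γ p n u + (1 + c) * (∑ i, p i) * ‖z - y‖ := by
  have h1 : ∑ i, p i * ((g (u i)).toReal - γ + ‖u i - z‖ / ((n i : ℝ) + 1)) ≤
      ∑ i, p i * ((g (u i)).toReal - γ + ‖u i - y‖ / ((n i : ℝ) + 1)) + (∑ i, p i) * ‖z - y‖ := by
    rw [Finset.sum_mul, ← Finset.sum_add_distrib]
    refine Finset.sum_le_sum fun i _ => ?_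
    rw [← mul_add]
    refine mul_le_mul_of_nonneg_left ?_ (hp i)
    have h2 : ‖u i - z‖ ≤ ‖u i - y‖ + ‖z - y‖ := by
      calc ‖u i - z‖ = ‖(u i - y) - (z - y)‖ := by congr 1; abel
        _ ≤ _ := norm_sub_le _ _
    have h3 : ‖u i - z‖ / ((n i : ℝ) + 1) ≤ (‖u i - y‖ + ‖z - y‖) / ((n i : ℝ) + 1) := by gcongr
    have h4 : ‖z - y‖ / ((n i : ℝ) + 1) ≤ ‖z - y‖ :=
      div_le_self (norm_nonneg _) (by linarith [(n i).cast_nonneg (α := ℝ)])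
    rw [add_div] at h3
    linarith
  have h2 : ‖∑ i, p i • (u i - z)‖ ≤ ‖∑ i, p i • (u i - y)‖ + (∑ i, p i) * ‖z - y‖ := by
    have h3 : ∑ i, p i • (u i - z) = ∑ i, p i • (u i - y) - (∑ i, p i) • (z - y) := by
      rw [Finset.sum_smul, ← Finset.sum_sub_distrib]
      refine Finset.sum_congr rfl fun i _ => ?_
      rw [← smul_sub]; congr 1; abel
    rw [h3]
    refine (norm_sub_le _ _).trans ?_
    rw [norm_smul, Real.norm_of_nonneg (Finset.sum_nonneg fun i _ => hp i)]
  have h3 := mul_le_mul_of_nonneg_left h2 hc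
  unfold configValue
  linarith

/-- As g need not be continuous, g y cannot be approximated by values at nearby base points.
Separating off γ lets a rational threshold encode it. -/
theorem configValue_eq_sub (g : X → EReal) (c : ℝ) (y : X) (γ : ℝ) {k : ℕ} (p : Fin k → ℝ)
    (n : Fin k → ℕ) (u : Fin k → X) :
    configValue g c y γ p n u = configValue g c y 0 p n u - (∑ i, p i) * γ := by
  unfold configValue
  rw [Finset.sum_mul, add_sub_right_comm, ← Finset.sum_sub_distrib]
  congr 1
  refine Finset.sum_congr rfl fun i _ => ?_
  ring

theorem exists_rat_weights (g : X → EReal) (c : ℝ) (y : X) (γ : ℝ) {k : ℕ} {p : Fin k → ℝ}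
    (hp : ∀ i, 0 ≤ p i) (n : Fin k → ℕ) (u : Fin k → X) (h : configValue g c y γ p n u < 0) :
    ∃ r : Fin k → ℚ, (∀ i, (0 : ℝ) ≤ r i) ∧ configValue g c y γ (fun i => (r i : ℝ)) n u < 0 := by
  have hcont : Continuous fun p : Fin k → ℝ => configValue g c y γ p n u := by
    unfold configValue; fun_prop
  obtain ⟨ε, hε, hball⟩ := Metric.eventually_nhds_iff_ball.1
    (hcont.continuousAt.eventually (gt_mem_nhds h))
  choose r hr1 hr2 using fun i => exists_rat_btwn (lt_add_of_pos_right (p i) hε)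
  refine ⟨r, fun i => (hp i).trans (hr1 i).le, hball _ ?_⟩
  rw [Metric.mem_ball, dist_pi_lt_iff hε]
  intro i
  rw [Real.dist_eq, abs_lt]
  constructor <;> linarith [hr1 i, hr2 i]

/-- Countably many rational tests, each with a witness found in the subspace, give a separable
subspace which detects every failing test of the whole space. -/
theorem exists_separable_detecting (g : X → EReal) {c : ℝ} (hc : 0 ≤ c) (x₀ : X) :
    ∃ Y : Submodule ℝ X, IsClosed (Y : Set X) ∧ TopologicalSpace.SeparableSpace Y ∧ x₀ ∈ Y ∧
      ∀ (y : X) (γ : ℝ) (k : ℕ) (p σ : Fin k → ℝ) (n : Fin k → ℕ) (u : Fin k → X), y ∈ Y →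
        (∀ i, 0 ≤ p i) → (∀ i, g (u i) ≠ ⊤) → (∀ i, ‖u i - y‖ < σ i) →
        configValue g c y γ p n u < 0 →
        ∃ (p' : Fin k → ℝ) (u' : Fin k → X), (∀ i, 0 ≤ p' i) ∧ (∀ i, u' i ∈ Y) ∧
          (∀ i, g (u' i) ≠ ⊤) ∧ (∀ i, ‖u' i - y‖ < σ i) ∧ configValue g c y γ p' n u' < 0 := by
  classical
  -- A test consists of rational weights, rational radii, indices n and a rational threshold; its
  -- value is one chosen witness, if any exists.
  let test : (Σ k : ℕ, (Fin k → ℚ) × (Fin k → ℚ) × (Fin k → ℕ) × ℚ) → X → Set X := fun τ z =>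
    if h : ∃ u : Fin τ.1 → X, (∀ i, g (u i) ≠ ⊤) ∧ (∀ i, ‖u i - z‖ < τ.2.2.1 i) ∧
      configValue g c z 0 (fun i => (τ.2.1 i : ℝ)) τ.2.2.2.1 u < τ.2.2.2.2
    then range h.choose else ∅
  let H : Unit ⊕ ℚ ⊕ (Σ k : ℕ, (Fin k → ℚ) × (Fin k → ℚ) × (Fin k → ℕ) × ℚ) → X → X → Set X :=
    Sum.elim (fun _ a b => {a + b}) (Sum.elim (fun r a _ => {(r : ℝ) • a}) (fun τ a _ => test τ a))
  have hH : ∀ i a b, (H i a b).Countable := by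
    rintro (_ | r | τ) a b
    · exact countable_singleton _
    · exact countable_singleton _
    · change (test τ a).Countable
      simp only [test]
      split_ifs
      · exact countable_range _
      · exact countable_empty
  obtain ⟨D, hDc, hSD, hD⟩ := exists_countable_closed_under hH (countable_singleton x₀)
  have hx₀ : x₀ ∈ D := hSD rfl
  have hadd : ∀ a ∈ D, ∀ b ∈ D, a + b ∈ D := fun a ha b hb => hD (Sum.inl ()) a ha b hb rfl
  have hsmul : ∀ (r : ℚ), ∀ a ∈ D, (r : ℝ) • a ∈ D := fun r a ha =>
    hD (Sum.inr (Sum.inl r)) a ha a ha rfl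
  have htest : ∀ τ, ∀ a ∈ D, test τ a ⊆ D := fun τ a ha =>
    hD (Sum.inr (Sum.inr τ)) a ha a ha
  let Y : Submodule ℝ X :=
    { carrier := closure D
      add_mem' := fun {a b} ha hb => map_mem_closure₂ continuous_add ha hb hadd
      zero_mem' := subset_closure (by simpa using hsmul 0 x₀ hx₀)
      smul_mem' := fun r a ha => by
        refine map_mem_closure₂ (f := fun (r : ℝ) (a : X) => r • a) (s := range ((↑) : ℚ → ℝ))
          continuous_smul (Rat.denseRange_cast r) ha ?_
        rintro _ ⟨s, rfl⟩ b hb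
        exact hsmul s b hb }
  refine ⟨Y, isClosed_closure, ?_, subset_closure hx₀, ?_⟩
  · exact (hDc.isSeparable.closure).separableSpace
  · intro y γ k p σ n u hy hp hu hσ hneg
    obtain ⟨r, hr, hrneg⟩ := exists_rat_weights g c y γ hp n u hneg
    set v := configValue g c y γ (fun i => (r i : ℝ)) n u with hv
    set Q : ℝ := (1 + c) * ∑ i, (r i : ℝ) with hQ
    have hQ0 : 0 ≤ Q := mul_nonneg (by linarith) (Finset.sum_nonneg fun i _ => hr i)
    -- The factors 2 pay for moving the base point from y to z and back.
    obtain ⟨β, hβ1, hβ2, hβ⟩ : ∃ β : ℝ, v + 2 * (Q * β) < 0 ∧ (∀ i, ‖u i - y‖ + 2 * β < σ i) ∧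
        0 < β := by
      have e1 : ∀ᶠ β : ℝ in 𝓝[>] 0, v + 2 * (Q * β) < 0 := by
        have : ContinuousAt (fun β : ℝ => v + 2 * (Q * β)) 0 := by fun_prop
        exact (this.eventually (gt_mem_nhds (by simpa using hrneg))).filter_mono nhdsWithin_le_nhds
      have e2 : ∀ᶠ β : ℝ in 𝓝[>] 0, ∀ i, ‖u i - y‖ + 2 * β < σ i := by
        refine eventually_all.2 fun i => ?_
        have : ContinuousAt (fun β : ℝ => ‖u i - y‖ + 2 * β) 0 := by fun_prop
        exact (this.eventually (gt_mem_nhds (by simpa using hσ i))).filter_mono nhdsWithin_le_nhds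
      exact (e1.and (e2.and self_mem_nhdsWithin)).exists
    obtain ⟨z, hzD, hzy⟩ := Metric.mem_closure_iff.1 (show y ∈ closure D from hy) β hβ
    rw [dist_comm, dist_eq_norm] at hzy
    choose ρ hρ1 hρ2 using fun i => exists_rat_btwn
      (show ‖u i - y‖ + β < σ i - β by linarith [hβ2 i])
    have hz := configValue_le_add g hc y z γ hr n u
    rw [configValue_eq_sub g c z] at hz
    have hQz : Q * ‖z - y‖ ≤ Q * β := by gcongr
    obtain ⟨t, ht1, ht2⟩ := exists_rat_btwn
      (show v + Q * β + (∑ i, (r i : ℝ)) * γ < (∑ i, (r i : ℝ)) * γ - Q * β by linarith)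
    have hex : ∃ u : Fin k → X, (∀ i, g (u i) ≠ ⊤) ∧ (∀ i, ‖u i - z‖ < ρ i) ∧
        configValue g c z 0 (fun i => (r i : ℝ)) n u < t := by
      refine ⟨u, hu, fun i => ?_, by linarith⟩
      have : ‖u i - z‖ ≤ ‖u i - y‖ + ‖z - y‖ := by
        calc ‖u i - z‖ = ‖(u i - y) - (z - y)‖ := by congr 1; abel
          _ ≤ _ := norm_sub_le _ _
      linarith [hρ1 i]
    have hsub := htest ⟨k, r, ρ, n, t⟩ z hzD
    simp only [test] at hsub
    rw [dif_pos hex] at hsub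
    obtain ⟨h1, h2, h3⟩ := hex.choose_spec
    refine ⟨fun i => r i, hex.choose, hr, fun i => subset_closure (hsub (mem_range_self i)), h1,
      fun i => ?_, ?_⟩
    · have : ‖hex.choose i - y‖ ≤ ‖hex.choose i - z‖ + ‖z - y‖ := by
        calc ‖hex.choose i - y‖ = ‖(hex.choose i - z) + (z - y)‖ := by congr 1; abel
          _ ≤ _ := norm_add_le _ _
      linarith [h2 i, hρ2 i]
    · have h4 := configValue_le_add g hc z y 0 hr n hex.choose
      rw [norm_sub_rev] at h4
      rw [configValue_eq_sub]
      linarith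

/-- If all finite tests succeed, the Hahn–Banach theorem gives a regular subgradient. -/
theorem exists_regularSubgradient_of_configValue {g : X → EReal} (hbot : ∀ x, g x ≠ ⊥) {y : X}
    (hy : g y ≠ ⊤) {c : ℝ} (hc : 0 ≤ c) {σ : ℕ → ℝ} (hσ : ∀ n, 0 < σ n)
    (hconf : ∀ (k : ℕ) (p : Fin k → ℝ) (n : Fin k → ℕ) (u : Fin k → X), (∀ i, 0 ≤ p i) →
      (∀ i, g (u i) ≠ ⊤) → (∀ i, ‖u i - y‖ < σ (n i)) →
      0 ≤ configValue g c y (g y).toReal p n u) :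
    ∃ w ∈ regularSubdifferential g y, ‖w‖ ≤ c := by
  -- The tests say exactly that the convex hull of A misses the open cone B. A separating functional
  -- (G, τ) has τ > 0, and -G/τ is the subgradient: A gives the subgradient inequality, B the norm
  -- bound.
  set A : Set (X × ℝ) := {q | ∃ n, ‖q.1‖ < σ n ∧ g (y + q.1) ≠ ⊤ ∧
    (g (y + q.1)).toReal - (g y).toReal + ‖q.1‖ / ((n : ℝ) + 1) = q.2} with hA
  set B : Set (X × ℝ) := {q | q.2 < -(c * ‖q.1‖)} with hB
  have hBo : IsOpen B := isOpen_lt (by fun_prop) (by fun_prop)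
  have hBc : Convex ℝ B := by
    intro q hq q' hq' a b ha hb hab
    simp only [hB, mem_ofPred_eq, Prod.fst_add, Prod.snd_add, Prod.smul_fst, Prod.smul_snd,
      smul_eq_mul] at hq hq' ⊢
    have h1 : ‖a • q.1 + b • q'.1‖ ≤ a * ‖q.1‖ + b * ‖q'.1‖ := by
      refine (norm_add_le _ _).trans ?_
      rw [norm_smul, norm_smul, Real.norm_of_nonneg ha, Real.norm_of_nonneg hb]
    have h2 := mul_le_mul_of_nonneg_left h1 hc
    rcases ha.eq_or_lt with rfl | ha'
    · have : b = 1 := by linarith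
      subst this
      linarith
    · have := mul_lt_mul_of_pos_left hq ha'
      have := mul_le_mul_of_nonneg_left hq'.le hb
      linarith
  have hdisj : Disjoint B (convexHull ℝ A) := by
    rw [Set.disjoint_left]
    intro q hqB hqA
    obtain ⟨ι, _, p, s, hp, -, hs, rfl⟩ := mem_convexHull_iff_exists_fintype.1 hqA
    choose n hn1 hn2 hn3 using hs
    let E := (Fintype.equivFin ι).symm
    have h := hconf (Fintype.card ι) (p ∘ E) (n ∘ E) (fun i => y + (s (E i)).1)
      (fun i => hp _) (fun i => hn2 _) (fun i => by simpa using hn1 (E i))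
    have h1 : configValue g c y (g y).toReal (p ∘ E) (n ∘ E) (fun i => y + (s (E i)).1) =
        ∑ i, p i * (s i).2 + c * ‖∑ i, p i • (s i).1‖ := by
      unfold configValue
      congr 1
      · rw [← E.sum_comp]
        refine Finset.sum_congr rfl fun i _ => ?_
        rw [← hn3 (E i)]
        simp
      · rw [← E.sum_comp (fun i => p i • (s i).1)]
        simp
    rw [h1] at h
    simp only [hB, mem_ofPred_eq, Prod.snd_sum, Prod.fst_sum, Prod.smul_fst, Prod.smul_snd,
      smul_eq_mul] at hqB
    linarith
  obtain ⟨F, b, hFB, hFA⟩ := geometric_hahn_banach_open hBc hBo (convex_convexHull ℝ A) hdisj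
  set G : StrongDual ℝ X := F.comp (ContinuousLinearMap.inl ℝ X ℝ) with hG
  set τ : ℝ := F (0, 1) with hτ
  have hF : ∀ h s, F (h, s) = G h + τ * s := by
    intro h s
    have : ((h, s) : X × ℝ) = (h, 0) + s • ((0, 1) : X × ℝ) := by simp
    rw [this, map_add, map_smul, smul_eq_mul, mul_comm]
    rfl
  have hb : b ≤ 0 := by
    have h0 : ((0, 0) : X × ℝ) ∈ A := ⟨0, by simpa using hσ 0, by simpa using hy, by simp⟩
    have := hFA _ (subset_convexHull ℝ A h0)
    rwa [hF, map_zero, mul_zero, add_zero] at this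
  have hB1 : ∀ h s, s < -(c * ‖h‖) → G h + τ * s < b := fun h s hs => by
    rw [← hF]; exact hFB _ hs
  have hτ0 : 0 < τ := by
    have := hB1 0 (-1) (by simp)
    simp at this
    linarith
  have hb0 : b = 0 := by
    refine le_antisymm hb ?_
    by_contra! hlt
    have := hB1 0 (b / τ) (by simpa using div_neg_of_neg_of_pos hlt hτ0)
    rw [map_zero, mul_div_cancel₀ _ hτ0.ne'] at this
    linarith
  subst hb0
  have hGle : ∀ h, G h ≤ τ * (c * ‖h‖) := by
    intro h
    refine le_of_forall_pos_lt_add fun ε hε => ?_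
    have h1 := hB1 h (-(c * ‖h‖) - ε / τ) (by have := div_pos hε hτ0; linarith)
    have h2 : τ * (ε / τ) = ε := mul_div_cancel₀ _ hτ0.ne'
    rw [mul_sub, h2] at h1
    linarith
  refine ⟨-(τ⁻¹ • G), ⟨hy, hbot y, fun ε hε => ?_⟩, ?_⟩
  · obtain ⟨n, hn⟩ := exists_nat_one_div_lt hε
    filter_upwards [Metric.ball_mem_nhds y (hσ n)] with x hx
    rw [Metric.mem_ball, dist_eq_norm] at hx
    by_cases hgx : g x = ⊤
    · rw [hgx]; exact le_top
    have hxA : ((x - y, (g x).toReal - (g y).toReal + ‖x - y‖ / ((n : ℝ) + 1)) : X × ℝ) ∈ A :=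
      ⟨n, hx, by simpa using hgx, by simp⟩
    have h1 := hFA _ (subset_convexHull ℝ A hxA)
    rw [hF] at h1
    have h2 : ‖x - y‖ / ((n : ℝ) + 1) ≤ ε * ‖x - y‖ := by
      rw [div_eq_mul_one_div, mul_comm]; gcongr
    rw [← EReal.coe_toReal hy (hbot y), ← EReal.coe_toReal hgx (hbot x), ← EReal.coe_add,
      EReal.coe_le_coe_iff]
    have h3 := mul_le_mul_of_nonneg_left h1 (inv_pos.2 hτ0).le
    rw [mul_zero, mul_add, ← mul_assoc, inv_mul_cancel₀ hτ0.ne', one_mul] at h3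
    have h4 : (-(τ⁻¹ • G)) (x - y) = -(τ⁻¹ * G (x - y)) := rfl
    rw [h4]
    linarith
  · rw [norm_neg]
    refine ContinuousLinearMap.opNorm_le_bound _ hc fun h => ?_
    have h1 : ∀ h, τ⁻¹ * G h ≤ c * ‖h‖ := fun h => by
      rw [inv_mul_le_iff₀ hτ0]; exact hGle h
    have h2 := h1 (-h)
    rw [map_neg, norm_neg] at h2
    change |τ⁻¹ * G h| ≤ _
    rw [abs_le]
    constructor
    · linarith
    · exact h1 h

/-- In an Asplund space, a point of slope at most `L` is a limit of points with regular
subgradients of norm almost at most `L`. -/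
theorem exists_regularSubgradient_of_slope [CompleteSpace X] (hX : IsAsplund X) {g : X → EReal}
    (hbot : ∀ x, g x ≠ ⊥) {x₀ : X} (hx₀ : g x₀ ≠ ⊤)
    (hlsc : ∀ᶠ x in 𝓝 x₀, LowerSemicontinuousAt g x) {L : ℝ} (hL : 0 ≤ L)
    (hmin : ∀ᶠ x in 𝓝 x₀, g x₀ + ((-(L * ‖x - x₀‖) : ℝ) : EReal) ≤ g x) {ε : ℝ} (hε : 0 < ε) :
    ∃ x, ‖x - x₀‖ < ε ∧ ∃ w ∈ regularSubdifferential g x, ‖w‖ ≤ L + ε := by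
  obtain ⟨Y, hYc, hYs, hx₀Y, hY⟩ := exists_separable_detecting g (show 0 ≤ L + ε by linarith) x₀
  have := hX Y hYs
  have : CompleteSpace Y := hYc.completeSpace_coe
  have hcont : Tendsto (fun y : Y => (y : X)) (𝓝 ⟨x₀, hx₀Y⟩) (𝓝 x₀) :=
    continuous_subtype_val.continuousAt
  obtain ⟨y, hyx, w, ⟨hgy, -, hw⟩, hwn⟩ := exists_regularSubgradient_of_separable
    (g := fun y : Y => g y) (u := ⟨x₀, hx₀Y⟩) (fun y => hbot y) hx₀
    ((hcont.eventually hlsc).mono fun y hy => hy.comp continuous_subtype_val.continuousAt) hL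
    (hcont.eventually hmin) hε
  refine ⟨y, hyx, ?_⟩
  have hσ : ∀ n : ℕ, ∃ σ : ℝ, 0 < σ ∧ ∀ u : Y, ‖(u : X) - y‖ < σ →
      g y + ((w (u - y) - 1 / ((n : ℝ) + 1) * ‖u - y‖ : ℝ) : EReal) ≤ g u := by
    -- The radii come from the subgradient on the subspace and are then used for tests in the whole
    -- space. A failed test there would produce one in the subspace, where w rules it out.
    intro n
    obtain ⟨σ, hσ, h⟩ := Metric.eventually_nhds_iff_ball.1
      (hw (1 / ((n : ℝ) + 1)) (by positivity))
    refine ⟨σ, hσ, fun u hu => h u ?_⟩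
    rw [Metric.mem_ball, dist_eq_norm]
    exact hu
  choose σ hσ0 hσ using hσ
  change g y ≠ ⊤ at hgy
  refine exists_regularSubgradient_of_configValue hbot hgy (by linarith) hσ0 ?_
  intro k p n u hp hu hun
  by_contra! hneg
  obtain ⟨p', u', hp', hu'Y, hu', hun', hneg'⟩ := hY y _ k p (fun i => σ (n i)) n u y.2 hp hu hun hneg
  let U : Fin k → Y := fun i => ⟨u' i, hu'Y i⟩
  have h1 : ∀ i, w (U i - y) ≤
      (g (u' i)).toReal - (g y).toReal + ‖u' i - y‖ / ((n i : ℝ) + 1) := by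
    intro i
    have h2 := hσ (n i) (U i) (hun' i)
    change _ ≤ g (u' i) at h2
    rw [← EReal.coe_toReal hgy (hbot y), ← EReal.coe_toReal (hu' i) (hbot _), ← EReal.coe_add,
      EReal.coe_le_coe_iff] at h2
    have h3 : ‖U i - y‖ = ‖u' i - y‖ := rfl
    rw [h3] at h2
    rw [div_eq_mul_one_div, mul_comm]
    linarith
  have h2 : w (∑ i, p' i • (U i - y)) ≤
      ∑ i, p' i * ((g (u' i)).toReal - (g y).toReal + ‖u' i - y‖ / ((n i : ℝ) + 1)) := by
    rw [map_sum]
    refine Finset.sum_le_sum fun i _ => ?_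
    rw [map_smul, smul_eq_mul]
    exact mul_le_mul_of_nonneg_left (h1 i) (hp' i)
  have h3 : ‖∑ i, p' i • (U i - y)‖ = ‖∑ i, p' i • (u' i - y)‖ := by
    rw [← Submodule.norm_coe]
    congr 1
    simp [U]
  have h4 : -((L + ε) * ‖∑ i, p' i • (u' i - y)‖) ≤ w (∑ i, p' i • (U i - y)) := by
    rw [← h3]
    have := (abs_le.1 (w.le_of_opNorm_le hwn (∑ i, p' i • (U i - y)))).1
    exact this
  unfold configValue at hneg'
  linarith

end SeparableReduction

/-! ### Subregularity and growth -/

section Subregularity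

variable {X : Type*} [NormedAddCommGroup X] [NormedSpace ℝ X]

theorem regularSubdifferential_subset_limitingSubdifferential (f : X → EReal) (x : X) :
    regularSubdifferential f x ⊆ limitingSubdifferential f x := fun w hw =>
  ⟨hw.1, hw.2.1, fun _ => x, fun _ => w, tendsto_const_nhds, tendsto_const_nhds,
    tendsto_const_nhds, fun _ => hw⟩

theorem add_mem_regularSubdifferential_of_tilt {f : X → EReal} (hf : ∀ x, f x ≠ ⊥) {x₀ x : X}
    {v w : StrongDual ℝ X}
    (hw : w ∈ regularSubdifferential (fun x => f x + ((-(v (x - x₀)) : ℝ) : EReal)) x) :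
    w + v ∈ regularSubdifferential f x := by
  obtain ⟨hx, -, hw⟩ := hw
  have hfx : f x ≠ ⊤ := fun h => hx (by simp only [h, EReal.top_add_coe])
  refine ⟨hfx, hf x, fun ε hε => ?_⟩
  filter_upwards [hw ε hε] with y hy
  by_cases hfy : f y = ⊤
  · rw [hfy]; exact le_top
  rw [← EReal.coe_toReal hfx (hf x), ← EReal.coe_toReal hfy (hf y)] at hy ⊢
  simp only [← EReal.coe_add, EReal.coe_le_coe_iff] at hy ⊢
  have h1 : v (y - x₀) = v (y - x) + v (x - x₀) := by rw [← map_add]; congr 1; abel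
  rw [_root_.add_apply]
  linarith

theorem abs_rpow_sub_rpow_le {p M a b : ℝ} (hp : 1 ≤ p) (ha : 0 ≤ a) (haM : a ≤ M) (hb : 0 ≤ b)
    (hbM : b ≤ M) : |a ^ p - b ^ p| ≤ p * M ^ (p - 1) * |a - b| := by
  have h := (convex_Icc (0 : ℝ) M).norm_image_sub_le_of_norm_hasDerivWithin_le
    (f := fun t : ℝ => t ^ p) (f' := fun t => p * t ^ (p - 1)) (C := p * M ^ (p - 1))
    (fun t _ => (Real.hasDerivAt_rpow_const (Or.inr hp)).hasDerivWithinAt)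
    (fun t ht => by
      rw [Real.norm_of_nonneg (mul_nonneg (by linarith) (Real.rpow_nonneg ht.1 _))]
      gcongr
      · exact ht.1
      · exact ht.2) ⟨hb, hbM⟩ ⟨ha, haM⟩
  simpa [Real.norm_eq_abs] using h

theorem distToInverse_nonneg (f : X → EReal) (v : StrongDual ℝ X) (x : X) :
    0 ≤ distToInverse f v x := Metric.infDist_nonneg

theorem distToInverse_le_add (f : X → EReal) (v : StrongDual ℝ X) (x y : X) :
    distToInverse f v x ≤ distToInverse f v y + ‖x - y‖ := by
  rw [← dist_eq_norm]; exact Metric.infDist_le_infDist_add_dist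

theorem distToInverse_le_norm {f : X → EReal} {v : StrongDual ℝ X} {u : X}
    (hu : v ∈ limitingSubdifferential f u) (x : X) : distToInverse f v x ≤ ‖x - u‖ := by
  rw [← dist_eq_norm]
  exact Metric.infDist_le_dist_of_mem (s := setValuedInverse (limitingSubdifferential f) v) hu

theorem LowerEstimate.mono {f : X → EReal} {q : ℝ} (hq : 0 < q) {x₀ : X} {v : StrongDual ℝ X}
    {c c' ρ : ℝ} (h : LowerEstimate f q x₀ v c ρ) (hc : c' ≤ c) : LowerEstimate f q x₀ v c' ρ := by
  intro x hx
  refine le_trans ?_ (h x hx)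
  have := distToInverse_nonneg f v x
  gcongr

/-- The q-th root of subregularity, tested on single subgradients; the constant is q/κ. -/
theorem IsSubregularWith.distToInverse_rpow_le {f : X → EReal} {q : ℝ} (hq : 0 < q) {x₀ : X}
    {v : StrongDual ℝ X} {κ : ℝ} (h : IsSubregularWith (limitingSubdifferential f) q x₀ v κ) :
    ∃ γ > 0, ∀ x ∈ Metric.ball x₀ γ, ∀ w ∈ limitingSubdifferential f x,
      q / (q * κ ^ (1 / q)) * distToInverse f v x ^ (1 / q) ≤ ‖w - v‖ := by
  obtain ⟨hmem, hκ, γ, hγ, hsub⟩ := h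
  refine ⟨γ, hγ, fun x hx w hw => ?_⟩
  have h1 := hsub x (Metric.ball_subset_closedBall hx)
  have h2 : Metric.infEDist v (limitingSubdifferential f x) ≤ ENNReal.ofReal ‖w - v‖ := by
    refine (Metric.infEDist_le_edist_of_mem hw).trans_eq ?_
    rw [edist_comm, edist_dist, dist_eq_norm]
  have h3 : Metric.infEDist x (setValuedInverse (limitingSubdifferential f) v) ≤
      ENNReal.ofReal (κ * ‖w - v‖ ^ q) := by
    rw [ENNReal.ofReal_mul hκ.le, ← ENNReal.ofReal_rpow_of_nonneg (norm_nonneg _) hq.le]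
    exact h1.trans (by gcongr)
  have h4 : distToInverse f v x ≤ κ * ‖w - v‖ ^ q :=
    ENNReal.toReal_le_of_le_ofReal (by positivity) h3
  have h5 : distToInverse f v x ^ (1 / q) ≤ κ ^ (1 / q) * ‖w - v‖ := by
    refine (Real.rpow_le_rpow (distToInverse_nonneg f v x) h4 (by positivity)).trans_eq ?_
    rw [Real.mul_rpow hκ.le (by positivity), ← Real.rpow_mul (norm_nonneg _),
      mul_one_div_cancel hq.ne', Real.rpow_one]
  have hκq : 0 < κ ^ (1 / q) := by positivity
  rw [← div_div, div_self hq.ne', one_div_mul_eq_div, div_le_iff₀ hκq]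
  linarith

/-- Under subregularity with constant `K`, a point at positive distance `d` from the solution set
cannot have a slope below `(K - |C|) d ^ (1 / q)` for the function penalized with constant `C`. -/
theorem slope_le_of_subregular [CompleteSpace X] (hX : IsAsplund X) {f : X → EReal}
    (hf : ∀ x, f x ≠ ⊥) {q : ℝ} (hq : 0 < q) {x₀ c : X} {v : StrongDual ℝ X} (hc : f c ≠ ⊤)
    (hlsc : ∀ᶠ x in 𝓝 c, LowerSemicontinuousAt f x) {K : ℝ} (hK : 0 ≤ K)
    (hsub : ∀ᶠ x in 𝓝 c, ∀ w ∈ limitingSubdifferential f x,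
      K * distToInverse f v x ^ (1 / q) ≤ ‖w - v‖)
    (hpos : 0 < distToInverse f v c) {C L : ℝ} (hL : 0 ≤ L)
    (hmin : ∀ᶠ y in 𝓝 c, f c + ((v (y - c) + q * C / (1 + q) *
      (distToInverse f v y ^ ((1 + q) / q) - distToInverse f v c ^ ((1 + q) / q)) -
        L * ‖y - c‖ : ℝ) : EReal) ≤ f y) :
    K * distToInverse f v c ^ (1 / q) ≤ |C| * distToInverse f v c ^ (1 / q) + L := by
  by_contra! hlt
  set d := distToInverse f v c with hd
  obtain ⟨ρ, hρ, hball⟩ := Metric.eventually_nhds_iff_ball.1 hsub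
  -- By continuity at ε = 0 the strict inequality survives a change of d by ε and a loss of ε in the
  -- subgradient norm.
  obtain ⟨ε, ⟨hε1, hε2, hε3⟩, hε⟩ : ∃ ε : ℝ, (|C| * (d + ε) ^ (1 / q) + L + ε <
      K * (d - ε) ^ (1 / q) ∧ ε < d ∧ ε < ρ) ∧ 0 < ε := by
    have e1 : ∀ᶠ ε : ℝ in 𝓝[>] 0, |C| * (d + ε) ^ (1 / q) + L + ε < K * (d - ε) ^ (1 / q) := by
      have c1 : ContinuousAt (fun ε : ℝ => |C| * (d + ε) ^ (1 / q) + L + ε) 0 :=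
        ((continuousAt_const.mul (ContinuousAt.rpow_const (by fun_prop)
          (Or.inr (by positivity)))).add continuousAt_const).add continuousAt_id
      have c2 : ContinuousAt (fun ε : ℝ => K * (d - ε) ^ (1 / q)) 0 :=
        continuousAt_const.mul (ContinuousAt.rpow_const (by fun_prop) (Or.inr (by positivity)))
      exact (c1.eventually_lt c2 (by simpa using hlt)).filter_mono nhdsWithin_le_nhds
    have e2 : ∀ᶠ ε : ℝ in 𝓝[>] 0, ε < d := (gt_mem_nhds hpos).filter_mono nhdsWithin_le_nhds
    have e3 : ∀ᶠ ε : ℝ in 𝓝[>] 0, ε < ρ := (gt_mem_nhds hρ).filter_mono nhdsWithin_le_nhds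
    exact ((e1.and (e2.and e3)).and self_mem_nhdsWithin).exists
  have hlin : Continuous fun x => -(v (x - x₀)) := by fun_prop
  have htop : f c + ((-(v (c - x₀)) : ℝ) : EReal) ≠ ⊤ := by
    rw [← EReal.coe_toReal hc (hf c), ← EReal.coe_add]; exact EReal.coe_ne_top _
  obtain ⟨x, hxc, w, hw, hwn⟩ := exists_regularSubgradient_of_slope hX
    (g := fun x => f x + ((-(v (x - x₀)) : ℝ) : EReal)) (x₀ := c)
    (L := |C| * (d + ε) ^ (1 / q) + L)
    (fun x h => by
      rcases EReal.add_eq_bot_iff.1 h with h | h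
      · exact hf x h
      · exact EReal.coe_ne_bot _ h)
    htop (hlsc.mono fun x hx => lowerSemicontinuousAt_add_coe hx hlin.continuousAt)
    (by positivity)
    (by
      filter_upwards [hmin, Metric.ball_mem_nhds c hε] with y hy hyc
      rw [Metric.mem_ball, dist_eq_norm] at hyc
      by_cases hfy : f y = ⊤
      · simp only [hfy, EReal.top_add_coe, le_top]
      rw [← EReal.coe_toReal hc (hf c), ← EReal.coe_toReal hfy (hf y)] at hy ⊢
      simp only [← EReal.coe_add, EReal.coe_le_coe_iff] at hy ⊢
      have hdy := distToInverse_le_add f v y c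
      have hdc := distToInverse_le_add f v c y
      rw [norm_sub_rev] at hdc
      have hp1 : (1 : ℝ) ≤ (1 + q) / q := by rw [le_div_iff₀ hq]; linarith
      have h1 := abs_rpow_sub_rpow_le hp1 (distToInverse_nonneg f v y)
        (show distToInverse f v y ≤ d + ε by linarith) hpos.le (show d ≤ d + ε by linarith)
      have h2 : (1 + q) / q - 1 = 1 / q := by field_simp; ring
      rw [h2] at h1
      have h3 : |distToInverse f v y - d| ≤ ‖y - c‖ := by
        rw [abs_le]; constructor <;> linarith
      have h4 : |q * C / (1 + q) * (distToInverse f v y ^ ((1 + q) / q) - d ^ ((1 + q) / q))| ≤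
          |C| * (d + ε) ^ (1 / q) * ‖y - c‖ := by
        rw [abs_mul, abs_div, abs_mul, abs_of_pos hq, abs_of_pos (show 0 < 1 + q by linarith)]
        calc q * |C| / (1 + q) * |distToInverse f v y ^ ((1 + q) / q) - d ^ ((1 + q) / q)|
            ≤ q * |C| / (1 + q) * ((1 + q) / q * (d + ε) ^ (1 / q) * ‖y - c‖) := by
              gcongr
              exact h1.trans (by gcongr)
          _ = |C| * (d + ε) ^ (1 / q) * ‖y - c‖ := by field_simp
      have h5 := (abs_le.1 h4).1
      have h6 : v (y - c) = v (y - x₀) - v (c - x₀) := by rw [← map_sub]; congr 1; abel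
      linarith) hε
  have hmem := regularSubdifferential_subset_limitingSubdifferential f x
    (add_mem_regularSubdifferential_of_tilt hf hw)
  have h1 := hball x (by rw [Metric.mem_ball, dist_eq_norm]; linarith) _ hmem
  rw [add_sub_cancel_right] at h1
  have h2 : d - ε ≤ distToInverse f v x := by
    have := distToInverse_le_add f v c x
    rw [norm_sub_rev] at this
    linarith
  have h3 : K * (d - ε) ^ (1 / q) ≤ K * distToInverse f v x ^ (1 / q) := by
    gcongr
  linarith

/-- Subregularity improves the constant of a lower estimate by a fixed amount. -/
theorem LowerEstimate.improve [CompleteSpace X] (hX : IsAsplund X) {f : X → EReal}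
    (hf : ∀ x, f x ≠ ⊥) {x₀ : X} (hdom : f x₀ ≠ ⊤)
    (hlsc : ∀ᶠ x in 𝓝 x₀, LowerSemicontinuousAt f x) {v : StrongDual ℝ X}
    (hv : v ∈ limitingSubdifferential f x₀) {q : ℝ} (hq : 0 < q) {K γ : ℝ} (hγ : 0 < γ)
    (hsub : ∀ x ∈ Metric.ball x₀ γ, ∀ w ∈ limitingSubdifferential f x,
      K * distToInverse f v x ^ (1 / q) ≤ ‖w - v‖)
    {C δ η : ℝ} (hδ : 0 < δ) (hη : 0 < η)
    (hCδ : |C| + 36 * 2 ^ (1 / q) * (q * δ / (1 + q)) < K) (h : LowerEstimate f q x₀ v C η) :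
    ∃ η' > 0, LowerEstimate f q x₀ v (C + δ) η' := by
  set σ := q * δ / (1 + q) with hσdef
  have hσ : 0 < σ := by positivity
  have hK : 0 < K := lt_of_le_of_lt (by positivity) hCδ
  set p := (1 + q) / q with hp
  have hp0 : 0 < p := by positivity
  obtain ⟨ρ, hρ, hlscρ⟩ := Metric.eventually_nhds_iff_ball.1 hlsc
  refine ⟨min (min η γ) ρ / 2, by positivity, fun x hx => ?_⟩
  have hηr : min (min η γ) ρ ≤ η := (min_le_left _ _).trans (min_le_left _ _)
  have hγr : min (min η γ) ρ ≤ γ := (min_le_left _ _).trans (min_le_right _ _)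
  have hρr : min (min η γ) ρ ≤ ρ := min_le_right _ _
  set R := min (min η γ) ρ with hR
  have hRpos : 0 < R := by positivity
  rw [Metric.mem_closedBall, dist_eq_norm] at hx
  obtain ⟨m, hm⟩ : ∃ m : ℝ, f x₀ = m := ⟨_, (EReal.coe_toReal hdom (hf x₀)).symm⟩
  have hcoef : q * (C + δ) / (1 + q) = q * C / (1 + q) + σ := by rw [hσdef]; ring
  -- On the zero set of the distance the constant plays no role.
  rcases (distToInverse_nonneg f v x).eq_or_lt with hD0 | hDpos
  · have h1 := h x (by rw [Metric.mem_closedBall, dist_eq_norm]; linarith)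
    rw [← hD0, Real.zero_rpow hp0.ne'] at h1 ⊢
    simpa using h1
  by_contra! hlt
  set D := distToInverse f v x with hD
  have hDR : D ≤ R / 2 := (distToInverse_le_norm hv x).trans hx
  have hnear : ∀ y ∈ Metric.closedBall x (D / 2), ‖y - x₀‖ < R := fun y hy => by
    rw [Metric.mem_closedBall, dist_eq_norm] at hy
    have : ‖y - x₀‖ ≤ ‖y - x‖ + ‖x - x₀‖ := by
      simpa using norm_add_le (y - x) (x - x₀)
    linarith
  have hcont : Continuous fun y => -(v (y - x₀)) -
      q * C / (1 + q) * distToInverse f v y ^ p := by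
    have h1 : Continuous fun y => distToInverse f v y := Metric.continuous_infDist_pt _
    have h2 : Continuous fun y => distToInverse f v y ^ p :=
      h1.rpow_const fun _ => Or.inr hp0.le
    fun_prop
  obtain ⟨c, hcK, hcx, hGc, hcmin⟩ := exists_small_slope (K := Metric.closedBall x (D / 2))
    Metric.isClosed_closedBall
    (G := fun y => f y + ((-(v (y - x₀)) - q * C / (1 + q) * distToInverse f v y ^ p : ℝ) : EReal))
    (fun y hy => lowerSemicontinuousAt_add_coe (hlscρ y (by
      rw [Metric.mem_ball, dist_eq_norm]; linarith [hnear y hy])) hcont.continuousAt)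
    (m := m) (fun y hy => by
      have h1 := h y (by rw [Metric.mem_closedBall, dist_eq_norm]; linarith [hnear y hy])
      by_cases hfy : f y = ⊤
      · simp only [hfy, EReal.top_add_coe, le_top]
      rw [hm, ← EReal.coe_toReal hfy (hf y)] at h1
      rw [← EReal.coe_toReal hfy (hf y)]
      simp only [← EReal.coe_add, EReal.coe_le_coe_iff] at h1 ⊢
      linarith)
    -- Failure at x bounds the defect by e. This a makes 9e/a = D/4, keeping c inside the ball and
    -- d(c) ≥ D/2.
    (x₀ := x) (Metric.mem_closedBall_self (by linarith)) (e := σ * D ^ p)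
    (a := 36 * σ * D ^ (1 / q)) (by positivity) (by positivity)
    (by
      have hfx : f x ≠ ⊤ := ne_top_of_lt hlt
      rw [hm, ← EReal.coe_toReal hfx (hf x)] at hlt
      rw [← EReal.coe_toReal hfx (hf x)]
      simp only [← EReal.coe_add, EReal.coe_le_coe_iff, EReal.coe_lt_coe_iff] at hlt ⊢
      rw [hcoef] at hlt
      linarith)
  have hDp : D ^ p = D * D ^ (1 / q) := by
    have : p = 1 + 1 / q := by rw [hp]; field_simp; ring
    rw [this, Real.rpow_add hDpos, Real.rpow_one]
  have hcx' : ‖c - x‖ ≤ D / 4 := by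
    refine hcx.trans (le_of_eq ?_)
    rw [hDp]
    have : D ^ (1 / q) ≠ 0 := by positivity
    field_simp; norm_num
  have hfc : f c ≠ ⊤ := fun h => hGc (by simp only [h, EReal.top_add_coe])
  have hdc : D / 2 ≤ distToInverse f v c := by
    have := distToInverse_le_add f v x c
    rw [norm_sub_rev] at this
    linarith
  have hcR := hnear c hcK
  have hslope := slope_le_of_subregular hX hf hq (x₀ := x₀) (c := c) (v := v) hfc
    (Filter.mem_of_superset (Metric.isOpen_ball.mem_nhds (show c ∈ Metric.ball x₀ ρ by
      rw [Metric.mem_ball, dist_eq_norm]; linarith)) hlscρ)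
    hK.le
    (Filter.mem_of_superset (Metric.isOpen_ball.mem_nhds (show c ∈ Metric.ball x₀ γ by
      rw [Metric.mem_ball, dist_eq_norm]; linarith)) hsub)
    (by linarith) (C := C) (L := 36 * σ * D ^ (1 / q)) (by positivity)
    (by
      have hnhds : Metric.closedBall x (D / 2) ∈ 𝓝 c := by
        refine Filter.mem_of_superset
          (Metric.isOpen_ball.mem_nhds (show c ∈ Metric.ball x (D / 2) by
            rw [Metric.mem_ball, dist_eq_norm]; linarith)) Metric.ball_subset_closedBall
      filter_upwards [hnhds] with y hy
      have h1 := hcmin y hy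
      by_cases hfy : f y = ⊤
      · rw [hfy]; exact le_top
      rw [← EReal.coe_toReal hfc (hf c), ← EReal.coe_toReal hfy (hf y)] at h1 ⊢
      simp only [← EReal.coe_add, EReal.coe_le_coe_iff] at h1 ⊢
      have h2 : v (y - c) = v (y - x₀) - v (c - x₀) := by rw [← map_sub]; congr 1; abel
      rw [h2, ← hp]
      linarith)
  set d := distToInverse f v c with hd
  have hdpos : 0 < d := by linarith
  have h1 : D ^ (1 / q) ≤ 2 ^ (1 / q) * d ^ (1 / q) := by
    rw [← Real.mul_rpow (by norm_num) hdpos.le]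
    exact Real.rpow_le_rpow hDpos.le (by linarith) (by positivity)
  have h2 : 0 < d ^ (1 / q) := by positivity
  have h3 : 36 * σ * D ^ (1 / q) ≤ 36 * σ * (2 ^ (1 / q) * d ^ (1 / q)) := by gcongr
  have h4 := mul_lt_mul_of_pos_right hCδ h2
  linarith

theorem exists_lowerEstimate_of_subregular [CompleteSpace X] (hX : IsAsplund X) {f : X → EReal}
    (hf : ∀ x, f x ≠ ⊥) {x₀ : X} (hdom : f x₀ ≠ ⊤)
    (hlsc : ∀ᶠ x in 𝓝 x₀, LowerSemicontinuousAt f x) {v : StrongDual ℝ X}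
    (hv : v ∈ limitingSubdifferential f x₀) {q : ℝ} (hq : 0 < q) {κ α : ℝ}
    (h : SubregularAndLowerEstimate f q x₀ v κ) (hα : 0 < α) (hακ : α < q / (q * κ ^ (1 / q))) :
    ∃ η : ℝ, 0 < η ∧ LowerEstimate f q x₀ v α η := by
  obtain ⟨hreg, γ', r, hγ', hr, hrκ, hlow⟩ := h
  obtain ⟨γ, hγ, hsub⟩ := hreg.distToInverse_rpow_le hq
  set K := q / (q * κ ^ (1 / q))
  have hM : max r α < K := max_lt hrκ hακ
  -- One increment serves every step, since all constants lie in [-r, α].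
  obtain ⟨δ, hδ1, hδ⟩ : ∃ δ : ℝ, max r α + 36 * 2 ^ (1 / q) * (q * δ / (1 + q)) < K ∧ 0 < δ := by
    have hc : ContinuousAt
        (fun δ : ℝ => max r α + 36 * 2 ^ (1 / q) * (q * δ / (1 + q))) 0 := by fun_prop
    have e1 : ∀ᶠ δ : ℝ in 𝓝[>] 0, max r α + 36 * 2 ^ (1 / q) * (q * δ / (1 + q)) < K :=
      (hc.eventually (gt_mem_nhds (by simpa using hM))).filter_mono nhdsWithin_le_nhds
    exact (e1.and self_mem_nhdsWithin).exists
  have hiter : ∀ n : ℕ, ∃ η > 0, LowerEstimate f q x₀ v (min α (-r + n * δ)) η := by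
    intro n
    induction n with
    | zero => exact ⟨γ', hγ', hlow.mono hq (by simp)⟩
    | succ n ih =>
      obtain ⟨η, hη, hest⟩ := ih
      have hnδ : 0 ≤ n * δ := by positivity
      have habs : |min α (-r + n * δ)| ≤ max r α := by
        rw [abs_le]
        refine ⟨le_min ?_ ?_, (min_le_left _ _).trans (le_max_right _ _)⟩
        · linarith [le_max_right r α]
        · linarith [le_max_left r α]
      obtain ⟨η', hη', hest'⟩ := hest.improve hX hf hdom hlsc hv hq hγ hsub hδ hη
        (by linarith)
      refine ⟨η', hη', hest'.mono hq ?_⟩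
      push_cast
      rw [← min_add_add_right]
      exact min_le_min (by linarith) (by linarith)
  obtain ⟨n, hn⟩ := exists_nat_ge ((α + r) / δ)
  obtain ⟨η, hη, hest⟩ := hiter n
  rw [div_le_iff₀ hδ] at hn
  rw [min_eq_left (by linarith)] at hest
  exact ⟨η, hη, hest⟩

theorem mul_distToInverse_le_of_graphEstimate {f : X → EReal} (hf : ∀ x, f x ≠ ⊥) {x₀ : X}
    (hdom : f x₀ ≠ ⊤) {v : StrongDual ℝ X} (hv : v ∈ limitingSubdifferential f x₀) {q : ℝ}
    (hq : 0 < q) {α β η R : ℝ} (hR : 0 < R) (hest : LowerEstimate f q x₀ v α η)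
    (hgraph : GraphEstimate f q x₀ v β R) {x : X} {w : StrongDual ℝ X}
    (hw : w ∈ limitingSubdifferential f x) (hxη : ‖x - x₀‖ ≤ η) (hxR : ‖x - x₀‖ < R / 2)
    (hxw : ‖x - x₀‖ + ‖w - v‖ ≤ R) :
    q * (α - β) / (1 + q) * distToInverse f v x ^ ((1 + q) / q) ≤
      ‖w - v‖ * distToInverse f v x := by
  have hp0 : (1 + q) / q ≠ 0 := by positivity
  have hstep : ∀ u, v ∈ limitingSubdifferential f u → ‖u - x₀‖ ≤ R →
      q * (α - β) / (1 + q) * distToInverse f v x ^ ((1 + q) / q) ≤ ‖w - v‖ * dist x u := by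
    intro u hu huR
    have h1 := hgraph u x w hu hw huR hxw
    have h2 := hgraph x₀ u v hv hu (by simpa using hR.le) (by simpa using huR)
    have h3 := hest x (by rwa [Metric.mem_closedBall, dist_eq_norm])
    have h0 : distToInverse f v u = 0 :=
      Metric.infDist_zero_of_mem (s := setValuedInverse (limitingSubdifferential f) v) hu
    rw [h0, Real.zero_rpow hp0] at h2
    rw [← EReal.coe_toReal hw.1 (hf x), ← EReal.coe_toReal hu.1 (hf u)] at h1
    rw [← EReal.coe_toReal hdom (hf x₀), ← EReal.coe_toReal hu.1 (hf u)] at h2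
    rw [← EReal.coe_toReal hdom (hf x₀), ← EReal.coe_toReal hw.1 (hf x)] at h3
    simp only [← EReal.coe_add, EReal.coe_le_coe_iff] at h1 h2 h3
    have h4 := (le_abs_self _).trans ((w - v).le_opNorm (x - u))
    rw [dist_eq_norm]
    simp only [_root_.sub_apply, map_sub] at h1 h2 h3 h4
    have h5 : q * (α - β) / (1 + q) = q * α / (1 + q) - q * β / (1 + q) := by ring
    rw [h5]
    linarith
  refine le_of_forall_pos_lt_add fun ε hε => ?_
  set d := distToInverse f v x with hd
  have hdx : d ≤ ‖x - x₀‖ := distToInverse_le_norm hv x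
  -- The first bound keeps the almost nearest u within R of x₀; the second makes the error less than
  -- ε.
  set t := min (R / 2 - ‖x - x₀‖) (ε / (‖w - v‖ + 1)) with ht
  have htpos : 0 < t := lt_min (by linarith) (by positivity)
  obtain ⟨u, hu, hxu⟩ := (Metric.infDist_lt_iff (x := x) (r := d + t)
    (s := setValuedInverse (limitingSubdifferential f) v) ⟨x₀, hv⟩).1
    (show d < d + t by linarith)
  have huR : ‖u - x₀‖ ≤ R := by
    have h1 : ‖u - x₀‖ ≤ ‖u - x‖ + ‖x - x₀‖ := by simpa using norm_add_le (u - x) (x - x₀)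
    rw [dist_comm, dist_eq_norm] at hxu
    linarith [min_le_left (R / 2 - ‖x - x₀‖) (ε / (‖w - v‖ + 1))]
  have h1 := hstep u hu huR
  have h2 : ‖w - v‖ * dist x u ≤ ‖w - v‖ * (d + t) := by gcongr
  have h3 : ‖w - v‖ * t < ε := by
    have h4 : (‖w - v‖ + 1) * t ≤ ε := by
      rw [mul_comm, ← le_div_iff₀ (by positivity)]; exact min_le_right _ _
    linarith
  linarith

theorem exists_subregular_of_lowerEstimate {f : X → EReal} (hf : ∀ x, f x ≠ ⊥) {x₀ : X}
    (hdom : f x₀ ≠ ⊤) {v : StrongDual ℝ X} (hv : v ∈ limitingSubdifferential f x₀) {q : ℝ}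
    (hq : 0 < q) {α β η R : ℝ} (hα : 0 < α) (hη : 0 < η) (hβ : β < α) (hR : 0 < R)
    (hest : LowerEstimate f q x₀ v α η) (hgraph : GraphEstimate f q x₀ v β R) :
    ∃ κ : ℝ, SubregularAndLowerEstimate f q x₀ v κ := by
  set A := q * (α - β) / (1 + q) with hA
  have hApos : 0 < A := by have := sub_pos.2 hβ; positivity
  set κ := (1 / A) ^ q with hκdef
  have hκ : 0 < κ := by positivity
  have hbound : ∃ γ > 0, ∀ x ∈ Metric.closedBall x₀ γ, ∀ w ∈ limitingSubdifferential f x,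
      distToInverse f v x ≤ κ * ‖w - v‖ ^ q := by
    -- The last bound settles subgradients with ‖w - v‖ > R/2, which the graph estimate need not
    -- cover: there d(x) ≤ ‖x - x₀‖ suffices.
    refine ⟨min (min η (R / 3)) (κ * (R / 2) ^ q), by positivity, fun x hx w hw => ?_⟩
    rw [Metric.mem_closedBall, dist_eq_norm, le_min_iff, le_min_iff] at hx
    obtain ⟨⟨hx1, hx2⟩, hx3⟩ := hx
    by_cases hwR : ‖w - v‖ ≤ R / 2
    · have h1 := mul_distToInverse_le_of_graphEstimate hf hdom hv hq hR hest hgraph hw hx1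
        (by linarith) (by linarith)
      rcases (distToInverse_nonneg f v x).eq_or_lt with h0 | hpos
      · rw [← h0]; positivity
      have hp : (1 + q) / q = 1 / q + 1 := by field_simp
      rw [hp, Real.rpow_add hpos, Real.rpow_one, ← mul_assoc] at h1
      have h2 := le_of_mul_le_mul_right h1 hpos
      have h3 : distToInverse f v x ^ (1 / q) ≤ 1 / A * ‖w - v‖ := by
        rw [one_div_mul_eq_div, le_div_iff₀ hApos]; linarith
      have h4 := Real.rpow_le_rpow (by positivity) h3 hq.le
      rwa [← Real.rpow_mul hpos.le, one_div_mul_cancel hq.ne', Real.rpow_one,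
        Real.mul_rpow (by positivity) (norm_nonneg _)] at h4
    · refine ((distToInverse_le_norm hv x).trans hx3).trans ?_
      push Not at hwR
      gcongr
  obtain ⟨γ, hγ, hbound⟩ := hbound
  have hK : 0 < q / (q * κ ^ (1 / q)) := by positivity
  refine ⟨κ, ⟨hv, hκ, γ, hγ, fun x hx => ?_⟩, η, q / (q * κ ^ (1 / q)) / 2, hη, by positivity,
    by linarith, hest.mono hq (by linarith)⟩
  have hne : (setValuedInverse (limitingSubdifferential f) v).Nonempty := ⟨x₀, hv⟩
  rcases (limitingSubdifferential f x).eq_empty_or_nonempty with h0 | hnon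
  · rw [h0, Metric.infEDist_empty, ENNReal.top_rpow_of_pos hq,
      ENNReal.mul_top (by simpa using hκ)]
    exact le_top
  · have h1 : ENNReal.ofReal (distToInverse f v x) =
        Metric.infEDist x (setValuedInverse (limitingSubdifferential f) v) :=
      ENNReal.ofReal_toReal (Metric.infEDist_ne_top hne)
    have hdist : distToInverse f v x ≤
        κ * Metric.infDist v (limitingSubdifferential f x) ^ q := by
      -- The distance to ∂f(x) need not be attained, so it is approached from above.
      have hcont : ContinuousAt (fun t : ℝ => κ * t ^ q)
          (Metric.infDist v (limitingSubdifferential f x)) :=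
        continuousAt_const.mul (continuousAt_id.rpow_const (Or.inr hq.le))
      refine ge_of_tendsto (hcont.mono_left nhdsWithin_le_nhds :
        Tendsto _ (𝓝[>] Metric.infDist v (limitingSubdifferential f x)) _) ?_
      filter_upwards [self_mem_nhdsWithin] with t ht
      obtain ⟨w, hw, hwt⟩ := (Metric.infDist_lt_iff hnon).1 ht
      rw [dist_comm, dist_eq_norm] at hwt
      exact (hbound x hx w hw).trans (by gcongr)
    rw [← h1]
    refine (ENNReal.ofReal_le_ofReal hdist).trans_eq ?_
    rw [ENNReal.ofReal_mul hκ.le, ← ENNReal.ofReal_rpow_of_nonneg Metric.infDist_nonneg hq.le,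
      Metric.infDist, ENNReal.ofReal_toReal (Metric.infEDist_ne_top hnon)]

end Subregularity

end VarAnalysis

theorem theorem3p4 {X : Type*} [NormedAddCommGroup X] [NormedSpace ℝ X] [CompleteSpace X]
    (f : X → EReal) (hf : ∀ x, f x ≠ ⊥) (x₀ : X) (hdom : f x₀ ≠ ⊤)
    (hlsc : ∀ᶠ x in 𝓝 x₀, LowerSemicontinuousAt f x)
    (v : StrongDual ℝ X) (hv : v ∈ limitingSubdifferential f x₀) (q : ℝ) (hq : 0 < q) :
    (∀ α η : ℝ, 0 < α → 0 < η → LowerEstimate f q x₀ v α η →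
      (∃ β : ℝ, 0 < β ∧ β < α ∧
        GraphEstimate f q x₀ v β (η + (q * η / (1 + q)) ^ (1 / q))) →
      ∃ κ' : ℝ, SubregularAndLowerEstimate f q x₀ v κ') ∧
    (IsAsplund X → ∀ κ' : ℝ, SubregularAndLowerEstimate f q x₀ v κ' →
      ∀ α : ℝ, 0 < α → α < q / (q * κ' ^ (1 / q)) →
        ∃ η : ℝ, 0 < η ∧ LowerEstimate f q x₀ v α η) := by
  refine ⟨?_, fun hX κ' h α hα hακ =>
    exists_lowerEstimate_of_subregular hX hf hdom hlsc hv hq h hα hακ⟩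
  rintro α η hα hη hest ⟨β, -, hβ, hgraph⟩
  exact exists_subregular_of_lowerEstimate hf hdom hv hq hα hη hβ (by positivity) hest hgraph
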